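/- Let $k\ge 2$. A $k$-Stirling permutation of order $n$ is a permutation of the multiset $\{1^k,2^k,\dots,n^k\}$ such that, for each $i$, every element occurring between two occurrences of $i$ is at least $i$. Let $(\sigma_n)_{n\ge1}$ be random $k$-Stirling permutations, $\sigma_n$ of order $n$, defined on one probability space and growing by random addition of labels: $\sigma_1=1^k$, and $\sigma_{n+1}$ is obtained from $\sigma_n$ by inserting the string $(n+1)^k$ into one of the $kn+1$ gaps (including first and last) of $\sigma_n$, the gap being chosen uniformly and independently of all other choices. A block of $\sigma_n=a_1\cdots a_{kn}$ is a substring $a_p\cdots a_q$ with $a_p=a_q$ that is not contained in any larger such substring; $a_p$ is its label and $q-p+1$ its size. Let $\tilde K_{n,i}$ ($i\ge1$) be the size of the $i$th block of $\sigma_n$ when the blocks are ordered by increasing label, and let $K_{n,1}\ge K_{n,2}\ge\cdots$ be the block sizes in decreasing order (both are $0$ when $i$ exceeds the number of blocks). For $0\le\alpha<1$ and $\theta>-\alpha$, the Poisson–Dirichlet distribution $\mathrm{PD}(\alpha,\theta)$ is the law of the decreasing rearrangement of $\bigl(b_i\prod_{j<i}(1-b_j)\bigr)_{i\ge1}$,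 where $b_1,b_2,\dots$ are independent and $b_m\sim\mathrm{Beta}(1-\alpha,\theta+m\alpha)$. Then there are independent random variables $\beta_m\sim\mathrm{Beta}\bigl(\tfrac{k-1}{k},\tfrac{m+1}{k}\bigr)$, $m\ge1$, on the same probability space such that, with $\tilde V_i=\beta_i\prod_{j=1}^{i-1}(1-\beta_j)$, almost surely $\tilde K_{n,i}/(kn)\to\tilde V_i$ for every $i\ge1$, and such that the decreasing rearrangement $(V_i)_{i\ge1}$ of $(\tilde V_i)_{i\ge1}$ satisfies $$\frac1{kn}\bigl(K_{n,1},K_{n,2},\dots\bigr)\xrightarrow{\text{a.s.}}(V_1,V_2,\dots)\sim \mathrm{PD}\Bigl(\frac1k,\frac1k\Bigr)\qquad(n\to\infty).$$ Here, almost surely, $V_1\ge V_2\ge\dots\ge0$ and $\sum_iV_i=1$, and the convergence holds both componentwise and in $\ell^1$, i.e. $\sum_i\bigl|K_{n,i}/(kn)-V_i\bigr|\to0$. In particular, almost surely, $\tilde V_1,\tilde V_2,\dots$ has a greatest term and the largest block size satisfies $$\frac{K_{n,1}}{kn}\to V_1=\max_{i\ge1}\tilde V_i .$$ -/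

import Mathlib

open MeasureTheory ProbabilityTheory Filter Topology

/-- A word `l` is a `k`-Stirling permutation of order `n`: it is a permutation of the multiset
`{1^k, 2^k, …, n^k}`, and every element occurring between two occurrences of `i` is at
least `i`. -/
def IsStirlingPerm (k n : ℕ) (l : List ℕ) : Prop :=
  (∀ a : ℕ, l.count a = if 1 ≤ a ∧ a ≤ n then k else 0) ∧
    ∀ i j : ℕ, List.Sublist [i, j, i] l → i ≤ j

/-- The set of `k`-Stirling permutations of order `n`. -/
def StirlingPerm (k n : ℕ) : Type := {l : List ℕ // IsStirlingPerm k n l}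

/-- The word obtained from `l` by adding the string `a^k` in the gap after the first `g` letters. -/
def insertString (k a g : ℕ) (l : List ℕ) : List ℕ :=
  l.take g ++ List.replicate k a ++ l.drop g

theorem IsStirlingPerm.le_of_mem {k n : ℕ} {l : List ℕ} (h : IsStirlingPerm k n l) {a : ℕ}
    (ha : a ∈ l) : a ≤ n := by
  by_contra hn
  have h1 := List.count_pos_iff.2 ha
  rw [h.1 a, if_neg (by omega)] at h1
  omega

theorem IsStirlingPerm.insertString {k n : ℕ} {l : List ℕ} (h : IsStirlingPerm k n l) (g : ℕ) :
    IsStirlingPerm k (n + 1) (insertString k (n + 1) g l) := by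
  have hl : ∀ b ∈ l, b ≤ n := fun b hb => h.le_of_mem hb
  refine ⟨fun a => ?_, fun i j hs => ?_⟩
  · have h1 : l.count a = (l.take g).count a + (l.drop g).count a := by
      rw [← List.count_append, List.take_append_drop]
    have h2 := h.1 a
    simp only [_root_.insertString, List.count_append, List.count_replicate, beq_iff_eq]
    split_ifs at h2 ⊢ <;> omega
  · by_contra hij
    have hf : (_root_.insertString k (n + 1) g l).filter (· ≤ n) = l := by
      have e1 : (l.take g).filter (· ≤ n) = l.take g :=
        List.filter_eq_self.2 fun b hb => by simpa using hl b (List.mem_of_mem_take hb)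
      have e2 : (l.drop g).filter (· ≤ n) = l.drop g :=
        List.filter_eq_self.2 fun b hb => by simpa using hl b (List.mem_of_mem_drop hb)
      simp [_root_.insertString, List.filter_append, e1, e2]
    have hmem : i ∈ _root_.insertString k (n + 1) g l := hs.subset (by simp)
    have hi : i ≤ n + 1 := by
      simp only [_root_.insertString, List.mem_append, List.mem_replicate] at hmem
      rcases hmem with (hm | hm) | hm
      · exact (hl i (List.mem_of_mem_take hm)).trans (Nat.le_succ n)
      · exact hm.2.le
      · exact (hl i (List.mem_of_mem_drop hm)).trans (Nat.le_succ n)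
    rcases Nat.lt_or_ge n i with hin | hin
    · have hi' : i = n + 1 := by omega
      subst hi'
      have nt : n + 1 ∉ l.take g := fun hm => by
        have := hl _ (List.mem_of_mem_take hm); omega
      have nd : n + 1 ∉ l.drop g := fun hm => by
        have := hl _ (List.mem_of_mem_drop hm); omega
      rw [_root_.insertString, List.append_assoc, List.sublist_append_iff] at hs
      obtain ⟨a, b, hab, ha, hb⟩ := hs
      have ha0 : a = [] := by
        cases a with
        | nil => rfl
        | cons x xs =>
          simp only [List.cons_append, List.cons.injEq] at hab
          exact absurd (ha.subset (by simp [← hab.1])) nt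
      subst ha0
      simp only [List.nil_append] at hab
      subst hab
      have hr := hb.reverse
      simp only [List.reverse_append, List.reverse_replicate] at hr
      rw [List.sublist_append_iff] at hr
      obtain ⟨a, b, hab, ha, hb⟩ := hr
      have ha0 : a = [] := by
        cases a with
        | nil => rfl
        | cons x xs =>
          simp at hab
          exact absurd (List.mem_reverse.1 (ha.subset (by simp [← hab.1]))) nd
      subst ha0
      simp only [List.nil_append] at hab
      subst hab
      have : j ∈ List.replicate k (n + 1) := hb.subset (by simp)
      have := List.eq_of_mem_replicate this
      omega
    · have hs2 := hs.filter (· ≤ n)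
      rw [hf] at hs2
      have hj : j ≤ n := by omega
      simp only [List.filter_cons, hin, hj, decide_true, if_true, List.filter_nil] at hs2
      exact hij (h.2 i j hs2)

/-- Adding the string `(n+1)^k` to a `k`-Stirling permutation of order `n` in one of its
`kn + 1` gaps. -/
def StirlingPerm.insert {k n : ℕ} (s : StirlingPerm k n) (g : Fin (k * n + 1)) :
    StirlingPerm k (n + 1) :=
  ⟨insertString k (n + 1) g s.1, s.2.insertString g⟩

/-- The random `k`-Stirling permutations `σ 0, σ 1, σ 2, …` (`σ n` being of order `n`) grow by
random addition of new labels: `σ (n+1)` arises from `σ n` by adding the string `(n+1)^k` in a gap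
`G n` that is uniformly distributed over the `kn + 1` gaps, all these choices being
independent. -/
def IsRandomGrowth {Ω : Type*} [MeasurableSpace Ω] (k : ℕ) (μ : Measure Ω)
    (σ : (n : ℕ) → Ω → StirlingPerm k n) : Prop :=
  ∃ G : (n : ℕ) → Ω → Fin (k * n + 1),
    (∀ n, Measurable (G n)) ∧ iIndepFun G μ ∧
    (∀ n, ∀ g : Fin (k * n + 1), μ.real {ω | G n ω = g} = 1 / ((k : ℝ) * n + 1)) ∧
    ∀ᵐ ω ∂μ, ∀ n, σ (n + 1) ω = (σ n ω).insert (G n ω)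

/-- `l[p], …, l[q]` is a substring of `l` (indices from `0`) with equal first and last letter. -/
def HasEqualEnds (l : List ℕ) (p q : ℕ) : Prop :=
  p ≤ q ∧ q < l.length ∧ l[p]? = l[q]?

instance (l : List ℕ) (p q : ℕ) : Decidable (HasEqualEnds l p q) :=
  inferInstanceAs (Decidable (p ≤ q ∧ q < l.length ∧ l[p]? = l[q]?))

/-- The substring `l[p], …, l[q]` is a block of `l`: it has equal ends and is not contained in any
larger such substring. -/
def IsBlock (l : List ℕ) (p q : ℕ) : Prop :=
  HasEqualEnds l p q ∧
    ∀ p' ≤ p, ∀ q' < l.length, q ≤ q' → HasEqualEnds l p' q' → p' = p ∧ q' = q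

instance (l : List ℕ) (p q : ℕ) : Decidable (IsBlock l p q) :=
  inferInstanceAs (Decidable (HasEqualEnds l p q ∧
    ∀ p' ≤ p, ∀ q' < l.length, q ≤ q' → HasEqualEnds l p' q' → p' = p ∧ q' = q))

/-- The set of blocks of `l`, a block being given by the positions `(p, q)` of its ends. -/
def blocks (l : List ℕ) : Finset (ℕ × ℕ) :=
  (Finset.range l.length ×ˢ Finset.range l.length).filter fun b => IsBlock l b.1 b.2

/-- The size of the block with end positions `b = (p, q)`. -/
def blockSize (b : ℕ × ℕ) : ℕ := b.2 - b.1 + 1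

/-- The label of a block: its first letter. -/
def blockLabel (l : List ℕ) (b : ℕ × ℕ) : ℕ := l.getD b.1 0

/-- The size of the `(i+1)`-st block when the blocks are ordered by increasing label, i.e. of the
block such that exactly `i` blocks have smaller labels; `0` if there are at most `i` blocks. -/
def labelBlockSize (l : List ℕ) (i : ℕ) : ℕ :=
  ∑ b ∈ (blocks l).filter fun b =>
    ((blocks l).filter fun c => blockLabel l c < blockLabel l b).card = i, blockSize b

/-- The `(i+1)`-st largest block size, counted with multiplicity; `0` if there are at most
`i` blocks. -/
def sortedBlockSize (l : List ℕ) (i : ℕ) : ℕ :=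
  (((blocks l).val.map blockSize).sort (· ≥ ·)).getD i 0

/-- The stick-breaking sequence `b i * ∏ j < i, (1 - b j)`. -/
def stickBreaking (b : ℕ → ℝ) (i : ℕ) : ℝ := b i * ∏ j ∈ Finset.range i, (1 - b j)

/-- The decreasing rearrangement of a sequence of non-negative numbers tending to `0`: its
`(i+1)`-st largest term is the least `t ≥ 0` such that at most `i` terms exceed `t`. -/
noncomputable def decreasingRearrangement (x : ℕ → ℝ) (i : ℕ) : ℝ :=
  sInf {t : ℝ | 0 ≤ t ∧ {j : ℕ | t < x j}.encard ≤ i}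

theorem measurable_stickBreaking : Measurable stickBreaking :=
  measurable_pi_lambda _ fun i =>
    (measurable_pi_apply i).mul
      (Finset.measurable_prod _ fun j _ => (measurable_pi_apply j).const_sub 1)

theorem measurable_decreasingRearrangement : Measurable decreasingRearrangement := by
  have hc : ∀ (t : ℝ) (i : ℕ), MeasurableSet {x : ℕ → ℝ | {j : ℕ | t < x j}.encard ≤ i} := by
    intro t i
    have : {x : ℕ → ℝ | {j : ℕ | t < x j}.encard ≤ i} =
        (⋃ s ∈ {s : Finset ℕ | s.card = i + 1}, ⋂ j ∈ s, {x : ℕ → ℝ | t < x j})ᶜ := by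
      ext x
      simp only [Set.mem_ofPred_eq, Set.mem_compl_iff, Set.mem_iUnion, Set.mem_iInter, exists_prop]
      rw [← not_lt, not_iff_not]
      constructor
      · intro h
        have h' : ((i + 1 : ℕ) : ℕ∞) ≤ {j : ℕ | t < x j}.encard := by
          push_cast
          exact Order.add_one_le_of_lt h
        obtain ⟨r, hr, hr'⟩ := Set.exists_subset_encard_eq h'
        have hf : r.Finite := Set.finite_of_encard_eq_coe hr'
        refine ⟨hf.toFinset, ?_, fun j hj => hr (hf.mem_toFinset.1 hj)⟩
        rw [hf.encard_eq_coe_toFinset_card] at hr'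
        exact_mod_cast hr'
      · rintro ⟨s, hs, hsx⟩
        have h1 : (s : Set ℕ).encard ≤ {j : ℕ | t < x j}.encard :=
          Set.encard_le_encard fun j hj => hsx j hj
        rw [Set.encard_coe_eq_coe_finsetCard, hs] at h1
        refine lt_of_lt_of_le ?_ h1
        exact_mod_cast Nat.lt_succ_self i
    rw [this]
    refine (MeasurableSet.biUnion (Set.to_countable _) fun s _ => ?_).compl
    exact Finset.measurableSet_biInter s fun j _ =>
      measurableSet_lt measurable_const (measurable_pi_apply j)
  have hmono : ∀ (x : ℕ → ℝ) (i : ℕ) (s t : ℝ), s ≤ t → {j : ℕ | s < x j}.encard ≤ i →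
      {j : ℕ | t < x j}.encard ≤ i := fun x i s t hst h =>
    (Set.encard_le_encard fun j (hj : t < x j) => hst.trans_lt hj).trans h
  refine measurable_pi_lambda _ fun i => measurable_of_Iio fun c => ?_
  have hS : (fun x : ℕ → ℝ => decreasingRearrangement x i) ⁻¹' Set.Iio c =
      (⋃ q : ℚ, ⋃ _ : 0 ≤ q ∧ (q : ℝ) < c,
        {x : ℕ → ℝ | {j : ℕ | (q : ℝ) < x j}.encard ≤ i}) ∪
        ((⋃ m : ℕ, {x : ℕ → ℝ | {j : ℕ | (m : ℝ) < x j}.encard ≤ i})ᶜ ∩ {_x | 0 < c}) := by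
    ext x
    have hb : BddBelow {t : ℝ | 0 ≤ t ∧ {j : ℕ | t < x j}.encard ≤ i} := ⟨0, fun t ht => ht.1⟩
    simp only [decreasingRearrangement, Set.mem_preimage, Set.mem_Iio, Set.mem_union,
      Set.mem_iUnion, Set.mem_ofPred_eq, Set.mem_inter_iff, Set.mem_compl_iff, exists_prop]
    constructor
    · intro h
      rcases Set.eq_empty_or_nonempty {t : ℝ | 0 ≤ t ∧ {j : ℕ | t < x j}.encard ≤ i} with he | hne
      · right
        refine ⟨?_, by rwa [he, Real.sInf_empty] at h⟩
        rintro ⟨m, hm⟩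
        have : (m : ℝ) ∈ {t : ℝ | 0 ≤ t ∧ {j : ℕ | t < x j}.encard ≤ i} := ⟨m.cast_nonneg, hm⟩
        simp [he] at this
      · left
        obtain ⟨t, ht, htc⟩ := exists_lt_of_csInf_lt hne h
        obtain ⟨q, hq1, hq2⟩ := exists_rat_btwn htc
        refine ⟨q, ⟨?_, hq2⟩, hmono x i t q hq1.le ht.2⟩
        exact_mod_cast ht.1.trans hq1.le
    · rintro (⟨q, ⟨hq0, hqc⟩, hq⟩ | ⟨hn, hc0⟩)
      · exact (csInf_le hb ⟨by exact_mod_cast hq0, hq⟩).trans_lt hqc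
      · have he : {t : ℝ | 0 ≤ t ∧ {j : ℕ | t < x j}.encard ≤ i} = ∅ := by
          by_contra hne
          obtain ⟨t, ht⟩ := Set.nonempty_iff_ne_empty.2 hne
          obtain ⟨m, hm⟩ := exists_nat_ge t
          exact hn ⟨m, hmono x i t m hm ht.2⟩
        rwa [he, Real.sInf_empty]
  rw [hS]
  refine (MeasurableSet.iUnion fun q : ℚ => MeasurableSet.iUnion fun _ => hc q i).union
    ((MeasurableSet.iUnion fun m : ℕ => hc m i).compl.inter (MeasurableSet.const _))

/-- The Poisson-Dirichlet distribution `PD(α, θ)` (for `0 ≤ α < 1`, `θ > -α`): the law of the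
decreasing rearrangement of the stick-breaking sequence of independent variables
`b m ∼ Beta(1 - α, θ + (m + 1) α)`, `m = 0, 1, 2, …`. -/
noncomputable def poissonDirichlet (α θ : ℝ) : Measure (ℕ → ℝ) :=
  (Measure.infinitePi fun m : ℕ => betaMeasure (1 - α) (θ + ((m : ℝ) + 1) * α)).map
    fun b => decreasingRearrangement (stickBreaking b)

/-!
Only the block sizes in the order of the labels matter. A string `(n+1)^k` put in a gap strictly
inside a block enlarges that block by `k`; in any other gap it becomes a new block, with the
greatest label (`mem_blocks_insertString`, `labelBlockSize_insertString`). Since a block of size `s`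
has `s - 1` inner gaps (`card_gapRank_eq`), the sizes divided by `k` perform the Chinese restaurant
process with parameters `(1/k, 1/k)`.

For every `i`, the first string that does not hit one of the first `i` blocks creates the block of
rank `i`, and the later ones are the draws from a Pólya urn, in which that block competes with all
later blocks. The initial weights are `k - 1` and `i + 2`, and each draw adds `k`. For a polynomial
`P`, let `urnMoment k P C D` be the integral of `P` against the beta law with parameters `C / k` and
`D / k`; it is harmonic for an urn with weights `C` and `D` (`urnMoment_step`). A product of
harmonic functions of the first `m` urns is harmonic for the growing word (`IsGrown.sum_prod_urn`),
because a string can affect the urn `m` only if it misses the blocks `0, …, m - 1`, and in that case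
it affects the urns before `m` in a way that does not depend on the gap. So such products are
bounded martingales (`martingale_prod_urn`). The fractions of weight in the urns converge almost
surely by martingale convergence, and comparing the expectations of the products at time `0` and in
the limit gives the joint moments of the limit fractions (`integral_prod_limitFraction`). These are
the moments of independent beta variables, and moments determine laws on the unit cube
(`iIndepFun_of_integral_prod_polynomial`).

The limit of the moments can only be identified for urns that receive infinitely many draws. This is
obtained by induction: if the urns before `i` grow, then their limit fractions have beta laws, hence
are less than `1`, so that a positive proportion of the draws reaches the urn `i` (`ae_urnGrows`).
The same computation yields the stick-breaking form of the limits of the block sizes.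

The stick is used up, because `∏ j < m, (1 - β j)` has expectation at most `2 / (m + 2)`. Hence the
limits of the block proportions sum to `1`, and Scheffé's lemma turns componentwise convergence into
convergence in `ℓ¹`. The decreasing rearrangement preserves sums and is a contraction for the
supremum distance, which carries everything over to the sorted block sizes
(`sortedBlockSize_div_eq`, `tendsto_decreasingRearrangement`, `HasSum.decreasingRearrangement`).
-/

/-! ### Blocks of a word and the insertion of a string of new letters -/

/-- The new position of the letter at position `x` after `k` letters are added in gap `g`. -/
def shiftPos (k g x : ℕ) : ℕ := if x < g then x else x + k

theorem shiftPos_strictMono (k g : ℕ) : StrictMono (shiftPos k g) := by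
  intro x y h
  unfold shiftPos
  split_ifs <;> omega

theorem length_insertString {k a g : ℕ} {l : List ℕ} (hg : g ≤ l.length) :
    (insertString k a g l).length = l.length + k := by
  simp [insertString]; omega

theorem getElem?_insertString {k a g : ℕ} {l : List ℕ} (hg : g ≤ l.length) (x : ℕ) :
    (insertString k a g l)[x]? =
      if x < g then l[x]? else if x < g + k then some a else l[x - k]? := by
  unfold insertString
  rw [List.append_assoc]
  have hl : (l.take g).length = g := by simp [hg]
  split_ifs with h1 h2
  · rw [List.getElem?_append_left (by omega), List.getElem?_take_of_lt h1]
  · rw [List.getElem?_append_right (by omega), hl,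
      List.getElem?_append_left (by simp; omega), List.getElem?_replicate, if_pos (by omega)]
  · rw [List.getElem?_append_right (by omega), hl, List.getElem?_append_right (by simp; omega),
      List.length_replicate, List.getElem?_drop]
    congr 1; omega

theorem getElem?_insertString_shiftPos {k a g : ℕ} {l : List ℕ} (hg : g ≤ l.length) (x : ℕ) :
    (insertString k a g l)[shiftPos k g x]? = l[x]? := by
  rw [getElem?_insertString hg]
  unfold shiftPos
  split_ifs <;> first | rfl | omega | (congr 1; omega)

theorem shiftPos_lt_length_iff {k a g : ℕ} {l : List ℕ} (hg : g ≤ l.length) (x : ℕ) :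
    shiftPos k g x < (insertString k a g l).length ↔ x < l.length := by
  rw [length_insertString hg]
  unfold shiftPos
  split_ifs <;> omega

/-- A position after the insertion is either new or the new position of an old letter. -/
theorem eq_shiftPos_or (k g x : ℕ) : (∃ y, x = shiftPos k g y) ∨ (g ≤ x ∧ x < g + k) := by
  by_cases h : x < g
  · exact .inl ⟨x, by simp [shiftPos, h]⟩
  · by_cases h2 : x < g + k
    · exact .inr ⟨by omega, h2⟩
    · refine .inl ⟨x - k, ?_⟩
      unfold shiftPos
      split_ifs <;> omega

theorem hasEqualEnds_shiftPos_iff {k a g : ℕ} {l : List ℕ} (hg : g ≤ l.length) (p q : ℕ) :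
    HasEqualEnds (insertString k a g l) (shiftPos k g p) (shiftPos k g q) ↔
      HasEqualEnds l p q := by
  unfold HasEqualEnds
  rw [getElem?_insertString_shiftPos hg, getElem?_insertString_shiftPos hg,
    shiftPos_lt_length_iff hg, (shiftPos_strictMono k g).le_iff_le]

theorem hasEqualEnds_insertString_iff {k a g : ℕ} {l : List ℕ} (hg : g ≤ l.length) (ha : a ∉ l)
    (p q : ℕ) : HasEqualEnds (insertString k a g l) p q ↔
      (∃ p₀ q₀, p = shiftPos k g p₀ ∧ q = shiftPos k g q₀ ∧ HasEqualEnds l p₀ q₀) ∨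
        (g ≤ p ∧ p ≤ q ∧ q < g + k) := by
  have hnew : ∀ x, g ≤ x → x < g + k → (insertString k a g l)[x]? = some a := by
    intro x h1 h2
    rw [getElem?_insertString hg, if_neg (by omega), if_pos h2]
  have hold : ∀ y, l[y]? ≠ some a := fun y h => ha (List.mem_of_getElem? h)
  rcases eq_shiftPos_or k g p with ⟨p₀, rfl⟩ | hp
  · rcases eq_shiftPos_or k g q with ⟨q₀, rfl⟩ | hq
    · rw [hasEqualEnds_shiftPos_iff hg]
      constructor
      · exact fun h => .inl ⟨p₀, q₀, rfl, rfl, h⟩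
      · rintro (⟨p₁, q₁, h1, h2, h⟩ | h)
        · rwa [(shiftPos_strictMono k g).injective h1, (shiftPos_strictMono k g).injective h2]
        · unfold shiftPos at h
          split_ifs at h <;> omega
    · constructor
      · intro h
        have := h.2.2
        rw [getElem?_insertString_shiftPos hg, hnew q hq.1 hq.2] at this
        exact absurd this (hold _)
      · rintro (⟨p₁, q₁, h1, h2, h⟩ | h)
        · unfold shiftPos at h2
          split_ifs at h2 <;> omega
        · unfold shiftPos at h
          split_ifs at h <;> omega
  · rcases eq_shiftPos_or k g q with ⟨q₀, rfl⟩ | hq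
    · constructor
      · intro h
        have := h.2.2
        rw [getElem?_insertString_shiftPos hg, hnew p hp.1 hp.2] at this
        exact absurd this.symm (hold _)
      · rintro (⟨p₁, q₁, h1, h2, h⟩ | h)
        · unfold shiftPos at h1
          split_ifs at h1 <;> omega
        · unfold shiftPos at h
          split_ifs at h <;> omega
    · constructor
      · exact fun h => .inr ⟨hp.1, h.1, hq.2⟩
      · intro h
        refine ⟨?_, by rw [length_insertString hg]; omega, by
          rw [hnew p hp.1 hp.2, hnew q hq.1 hq.2]⟩
        rcases h with ⟨p₁, q₁, h1, h2, h⟩ | h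
        · unfold shiftPos at h1
          split_ifs at h1 <;> omega
        · exact h.2.1

/-- Every substring with equal ends lies in a block; in particular every letter does. -/
theorem HasEqualEnds.exists_isBlock {l : List ℕ} {p q : ℕ} (h : HasEqualEnds l p q) :
    ∃ p' q', IsBlock l p' q' ∧ p' ≤ p ∧ q ≤ q' := by
  induction hd : l.length - (q - p) using Nat.strong_induction_on generalizing p q with
  | _ d ih =>
    by_cases hb : IsBlock l p q
    · exact ⟨p, q, hb, le_rfl, le_rfl⟩
    · simp only [IsBlock, h, true_and, not_forall] at hb
      obtain ⟨p', hp', q', hq', hqq, he, hne⟩ := hb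
      have h1 := h.1
      obtain ⟨p₂, q₂, hb2, h3, h4⟩ := ih (l.length - (q' - p')) (by omega) he rfl
      exact ⟨p₂, q₂, hb2, by omega, by omega⟩

theorem mem_blocks {l : List ℕ} {b : ℕ × ℕ} : b ∈ blocks l ↔ IsBlock l b.1 b.2 := by
  simp only [blocks, Finset.mem_filter, Finset.mem_product, Finset.mem_range, and_iff_right_iff_imp]
  intro h
  have := h.1.1
  have := h.1.2.1
  omega

/-- The gap `g` lies strictly inside the block `b`. -/
def InBlock (g : ℕ) (b : ℕ × ℕ) : Prop := b.1 < g ∧ g ≤ b.2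

instance (g : ℕ) (b : ℕ × ℕ) : Decidable (InBlock g b) :=
  inferInstanceAs (Decidable (b.1 < g ∧ g ≤ b.2))

/-- The new position of a block after `k` letters are added in gap `g`. -/
def shiftBlock (k g : ℕ) (b : ℕ × ℕ) : ℕ × ℕ := (shiftPos k g b.1, shiftPos k g b.2)

theorem shiftBlock_injective (k g : ℕ) : Function.Injective (shiftBlock k g) := by
  rintro ⟨a, b⟩ ⟨c, d⟩ h
  simp only [shiftBlock, Prod.mk.injEq] at h
  rw [(shiftPos_strictMono k g).injective h.1, (shiftPos_strictMono k g).injective h.2]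

/-- Adding a string of new letters moves the old blocks, and creates a new block if and only if the
gap is not inside an old block. -/
theorem mem_blocks_insertString {k a g : ℕ} {l : List ℕ} (hk : 0 < k) (hg : g ≤ l.length)
    (ha : a ∉ l) (b : ℕ × ℕ) : b ∈ blocks (insertString k a g l) ↔
      (∃ c ∈ blocks l, b = shiftBlock k g c) ∨
        (b = (g, g + k - 1) ∧ ∀ c ∈ blocks l, ¬ InBlock g c) := by
  have hm := shiftPos_strictMono k g
  obtain ⟨p, q⟩ := b
  simp only [mem_blocks, shiftBlock, Prod.mk.injEq, Prod.exists, InBlock, Prod.forall]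
  constructor
  · rintro ⟨he, hmax⟩
    rcases (hasEqualEnds_insertString_iff hg ha p q).1 he with ⟨p₀, q₀, rfl, rfl, h0⟩ | h
    · refine .inl ⟨p₀, q₀, ⟨h0, fun p' hp' q' hq' hqq h' => ?_⟩, rfl, rfl⟩
      have := hmax (shiftPos k g p') (hm.monotone hp') (shiftPos k g q')
        ((shiftPos_lt_length_iff hg _).2 hq') (hm.monotone hqq)
        ((hasEqualEnds_shiftPos_iff hg _ _).2 h')
      exact ⟨hm.injective this.1, hm.injective this.2⟩
    · refine .inr ⟨?_, fun c d hcd hin => ?_⟩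
      · have := hmax g h.1 (g + k - 1) (by rw [length_insertString hg]; omega) (by omega)
          ((hasEqualEnds_insertString_iff hg ha _ _).2 (.inr ⟨le_rfl, by omega, by omega⟩))
        exact ⟨this.1.symm, this.2.symm⟩
      · have := hmax (shiftPos k g c) (by unfold shiftPos; split_ifs <;> omega) (shiftPos k g d)
          ((shiftPos_lt_length_iff hg _).2 hcd.1.2.1) (by unfold shiftPos; split_ifs <;> omega)
          ((hasEqualEnds_shiftPos_iff hg _ _).2 hcd.1)
        unfold shiftPos at this
        split_ifs at this <;> omega
  · rintro (⟨c, d, hcd, rfl, rfl⟩ | ⟨⟨rfl, rfl⟩, hno⟩)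
    · refine ⟨(hasEqualEnds_shiftPos_iff hg _ _).2 hcd.1, fun p' hp' q' hq' hqq h' => ?_⟩
      rcases (hasEqualEnds_insertString_iff hg ha _ _).1 h' with ⟨p₀, q₀, rfl, rfl, h0⟩ | h
      · have := hcd.2 p₀ (hm.le_iff_le.1 hp') q₀ h0.2.1 (hm.le_iff_le.1 hqq) h0
        rw [this.1, this.2]; exact ⟨rfl, rfl⟩
      · have h1 := hcd.1.1
        unfold shiftPos at hp' hqq
        split_ifs at hp' hqq <;> omega
    · refine ⟨(hasEqualEnds_insertString_iff hg ha _ _).2 (.inr ⟨le_rfl, by omega, by omega⟩),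
        fun p' hp' q' hq' hqq h' => ?_⟩
      rcases (hasEqualEnds_insertString_iff hg ha _ _).1 h' with ⟨p₀, q₀, rfl, rfl, h0⟩ | h
      · obtain ⟨c, d, hcd, h3, h4⟩ := h0.exists_isBlock
        refine absurd ?_ (hno c d hcd)
        unfold shiftPos at hp' hqq
        split_ifs at hp' hqq <;> omega
      · omega

theorem blockLabel_shiftBlock {k a g : ℕ} {l : List ℕ} (hg : g ≤ l.length) (b : ℕ × ℕ) :
    blockLabel (insertString k a g l) (shiftBlock k g b) = blockLabel l b := by
  simp only [blockLabel, shiftBlock, List.getD_eq_getElem?_getD,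
    getElem?_insertString_shiftPos hg]

theorem blockLabel_mem {l : List ℕ} {b : ℕ × ℕ} (hb : b ∈ blocks l) : blockLabel l b ∈ l := by
  rw [mem_blocks] at hb
  have h : b.1 < l.length := lt_of_le_of_lt hb.1.1 hb.1.2.1
  simp only [blockLabel, List.getD_eq_getElem?_getD, List.getElem?_eq_getElem h, Option.getD_some]
  exact List.getElem_mem h

theorem blockLabel_new {k a g : ℕ} {l : List ℕ} (hk : 0 < k) (hg : g ≤ l.length) :
    blockLabel (insertString k a g l) (g, g + k - 1) = a := by
  simp only [blockLabel, List.getD_eq_getElem?_getD, getElem?_insertString hg]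
  simp [hk]

/-- Two substrings with equal ends and the same letter at these ends span another such substring,
so distinct blocks have distinct labels. -/
theorem blockLabel_injOn (l : List ℕ) : Set.InjOn (blockLabel l) (blocks l) := by
  rintro ⟨p, q⟩ hb ⟨p', q'⟩ hc h
  rw [Finset.mem_coe, mem_blocks] at hb hc
  dsimp only at hb hc
  have h1 := hb.1.1
  have h2 := hc.1.1
  have h3 := hb.1.2.1
  have h4 := hc.1.2.1
  have h5 : l[p]? = l[p']? := by
    simp only [blockLabel, List.getD_eq_getElem?_getD,
      List.getElem?_eq_getElem (show p < l.length by omega),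
      List.getElem?_eq_getElem (show p' < l.length by omega), Option.getD_some] at h ⊢
    rw [h]
  have key : HasEqualEnds l (min p p') (max q q') := by
    refine ⟨by omega, by omega, ?_⟩
    rcases min_choice p p' with e | e <;> rcases max_choice q q' with f | f <;> rw [e, f]
    · exact hb.1.2.2
    · rw [h5]; exact hc.1.2.2
    · rw [← h5]; exact hb.1.2.2
    · exact hc.1.2.2
  have i1 := hb.2 _ (min_le_left _ _) _ key.2.1 (le_max_left _ _) key
  have i2 := hc.2 _ (min_le_right _ _) _ key.2.1 (le_max_right _ _) key
  rw [← i1.1, ← i1.2, ← i2.1, ← i2.2]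
  simp [i1]

/-! ### Block sizes ordered by label -/

/-- The number of blocks whose label is smaller than that of `b`. -/
def labelRank (l : List ℕ) (b : ℕ × ℕ) : ℕ :=
  ((blocks l).filter fun c => blockLabel l c < blockLabel l b).card

theorem labelRank_lt {l : List ℕ} {b : ℕ × ℕ} (hb : b ∈ blocks l) :
    labelRank l b < (blocks l).card :=
  Finset.card_lt_card (Finset.filter_ssubset.2 ⟨b, hb, lt_irrefl _⟩)

theorem labelRank_injOn (l : List ℕ) : Set.InjOn (labelRank l) (blocks l) := by
  have key : ∀ b ∈ blocks l, ∀ c ∈ blocks l, blockLabel l b < blockLabel l c →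
      labelRank l b < labelRank l c := by
    intro b hb c hc h
    refine Finset.card_lt_card ⟨fun x hx => ?_, fun hs => ?_⟩
    · rw [Finset.mem_filter] at hx ⊢
      exact ⟨hx.1, hx.2.trans h⟩
    · have := hs (Finset.mem_filter.2 ⟨hb, h⟩)
      exact lt_irrefl _ (Finset.mem_filter.1 this).2
  intro b hb c hc h
  by_contra hne
  rcases lt_or_gt_of_ne (fun e => hne (blockLabel_injOn l hb hc e)) with h1 | h1
  · exact (key b hb c hc h1).ne h
  · exact (key c hc b hb h1).ne h.symm

theorem exists_labelRank_eq {l : List ℕ} {i : ℕ} (hi : i < (blocks l).card) :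
    ∃ b ∈ blocks l, labelRank l b = i := by
  have h := Finset.surj_on_of_inj_on_of_card_le (s := blocks l)
    (t := Finset.range (blocks l).card) (fun b _ => labelRank l b)
    (fun b hb => Finset.mem_range.2 (labelRank_lt hb))
    (fun b c hb hc h => labelRank_injOn l hb hc h) (by simp) i (Finset.mem_range.2 hi)
  obtain ⟨b, hb, h⟩ := h
  exact ⟨b, hb, h.symm⟩

theorem labelBlockSize_labelRank {l : List ℕ} {b : ℕ × ℕ} (hb : b ∈ blocks l) :
    labelBlockSize l (labelRank l b) = blockSize b := by
  unfold labelBlockSize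
  refine Finset.sum_eq_single b (fun c hc hne => ?_) fun h => ?_
  · rw [Finset.mem_filter] at hc
    exact absurd (labelRank_injOn l hc.1 hb hc.2) hne
  · exact absurd (Finset.mem_filter.2 ⟨hb, (rfl : labelRank l b = labelRank l b)⟩) h

theorem labelBlockSize_eq_zero {l : List ℕ} {i : ℕ} (hi : (blocks l).card ≤ i) :
    labelBlockSize l i = 0 := by
  unfold labelBlockSize
  refine Finset.sum_eq_zero fun b hb => ?_
  rw [Finset.mem_filter] at hb
  have := labelRank_lt hb.1
  unfold labelRank at this
  omega

/-- The rank, in the order of the labels, of the block that a string of new largest letters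
belongs to when it is added in gap `g`: that of the block around `g` if there is one, and the
number of blocks otherwise. -/
def gapRank (l : List ℕ) (g : ℕ) : ℕ :=
  ((blocks l).filter fun c => ∀ b ∈ blocks l, InBlock g b → blockLabel l c < blockLabel l b).card

/-- Distinct blocks of `l` are disjoint. -/
def DisjointBlocks (l : List ℕ) : Prop :=
  ∀ b ∈ blocks l, ∀ c ∈ blocks l, b ≠ c → b.2 < c.1 ∨ c.2 < b.1

theorem DisjointBlocks.eq_of_inBlock {l : List ℕ} (h : DisjointBlocks l) {g : ℕ} {b c : ℕ × ℕ}
    (hb : b ∈ blocks l) (hc : c ∈ blocks l) (hgb : InBlock g b) (hgc : InBlock g c) : b = c := by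
  by_contra hne
  have := h b hb c hc hne
  unfold InBlock at hgb hgc
  omega

theorem gapRank_of_inBlock {l : List ℕ} (h : DisjointBlocks l) {g : ℕ} {b : ℕ × ℕ}
    (hb : b ∈ blocks l) (hg : InBlock g b) : gapRank l g = labelRank l b := by
  unfold gapRank labelRank
  congr 1
  refine Finset.filter_congr fun c _ => ⟨fun h' => h' b hb hg, fun h' b' hb' hg' => ?_⟩
  rwa [h.eq_of_inBlock hb' hb hg' hg]

theorem gapRank_of_not_inBlock {l : List ℕ} {g : ℕ} (hg : ∀ b ∈ blocks l, ¬ InBlock g b) :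
    gapRank l g = (blocks l).card := by
  unfold gapRank
  rw [Finset.filter_true_of_mem]
  exact fun c _ b hb hgb => absurd hgb (hg b hb)

theorem gapRank_le (l : List ℕ) (g : ℕ) : gapRank l g ≤ (blocks l).card :=
  Finset.card_filter_le _ _

/-- A block of size `s` has `s - 1` inner gaps. -/
theorem card_gapRank_eq {l : List ℕ} (h : DisjointBlocks l) {i : ℕ} (hi : i < (blocks l).card) :
    ((Finset.range (l.length + 1)).filter fun g => gapRank l g = i).card + 1 =
      labelBlockSize l i := by
  obtain ⟨b, hb, rfl⟩ := exists_labelRank_eq hi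
  have : ((Finset.range (l.length + 1)).filter fun g => gapRank l g = labelRank l b) =
      Finset.Ioc b.1 b.2 := by
    ext g
    simp only [Finset.mem_filter, Finset.mem_range, Finset.mem_Ioc]
    constructor
    · rintro ⟨_, h2⟩
      by_cases hin : ∃ c ∈ blocks l, InBlock g c
      · obtain ⟨c, hc, hgc⟩ := hin
        rw [gapRank_of_inBlock h hc hgc] at h2
        rw [← labelRank_injOn l hc hb h2]
        exact hgc
      · push Not at hin
        rw [gapRank_of_not_inBlock hin] at h2
        omega
    · intro hg
      have := (mem_blocks.1 hb).1.2.1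
      exact ⟨by omega, gapRank_of_inBlock h hb hg⟩
  rw [this, Nat.card_Ioc, labelBlockSize_labelRank hb]
  rfl

theorem blockSize_shiftBlock {k g : ℕ} {b : ℕ × ℕ} (hb : b.1 ≤ b.2) :
    blockSize (shiftBlock k g b) = blockSize b + if InBlock g b then k else 0 := by
  unfold blockSize shiftBlock shiftPos
  dsimp only
  by_cases h : InBlock g b
  · rw [if_pos h]
    unfold InBlock at h
    split_ifs <;> omega
  · rw [if_neg h]
    unfold InBlock at h
    split_ifs <;> omega

section Insert

variable {k a g : ℕ} {l : List ℕ}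

theorem labelRank_shiftBlock (hk : 0 < k) (hg : g ≤ l.length)
    (ha : ∀ b ∈ l, b < a) {b : ℕ × ℕ} (hb : b ∈ blocks l) :
    labelRank (insertString k a g l) (shiftBlock k g b) = labelRank l b := by
  have ha' : a ∉ l := fun h => lt_irrefl _ (ha a h)
  unfold labelRank
  rw [← Finset.card_image_of_injective ((blocks l).filter fun c => blockLabel l c < blockLabel l b)
    (shiftBlock_injective k g)]
  congr 1
  ext c
  simp only [Finset.mem_filter, Finset.mem_image, mem_blocks_insertString hk hg ha',
    blockLabel_shiftBlock hg]
  constructor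
  · rintro ⟨⟨c, hc, rfl⟩ | ⟨rfl, _⟩, hlt⟩
    · rw [blockLabel_shiftBlock hg] at hlt
      exact ⟨c, ⟨hc, hlt⟩, rfl⟩
    · rw [blockLabel_new hk hg] at hlt
      have := ha _ (blockLabel_mem hb)
      omega
  · rintro ⟨c, ⟨hc, hlt⟩, rfl⟩
    exact ⟨.inl ⟨c, hc, rfl⟩, by rwa [blockLabel_shiftBlock hg]⟩

theorem labelRank_new (hk : 0 < k) (hg : g ≤ l.length) (ha : ∀ b ∈ l, b < a) :
    labelRank (insertString k a g l) (g, g + k - 1) = (blocks l).card := by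
  have ha' : a ∉ l := fun h => lt_irrefl _ (ha a h)
  unfold labelRank
  rw [← Finset.card_image_of_injective (blocks l) (shiftBlock_injective k g)]
  congr 1
  ext c
  simp only [Finset.mem_filter, Finset.mem_image, mem_blocks_insertString hk hg ha',
    blockLabel_new hk hg]
  constructor
  · rintro ⟨⟨c, hc, rfl⟩ | ⟨rfl, _⟩, hlt⟩
    · exact ⟨c, hc, rfl⟩
    · rw [blockLabel_new hk hg] at hlt
      omega
  · rintro ⟨c, hc, rfl⟩
    exact ⟨.inl ⟨c, hc, rfl⟩, by rw [blockLabel_shiftBlock hg]; exact ha _ (blockLabel_mem hc)⟩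

theorem blocks_insertString (hk : 0 < k) (hg : g ≤ l.length) (ha : a ∉ l) :
    blocks (insertString k a g l) = (blocks l).image (shiftBlock k g) ∪
      if ∃ c ∈ blocks l, InBlock g c then ∅ else {(g, g + k - 1)} := by
  ext b
  rw [mem_blocks_insertString hk hg ha]
  split_ifs with h
  · have : ¬ ∀ c ∈ blocks l, ¬ InBlock g c := by push Not; exact h
    simp only [this, and_false, or_false, Finset.union_empty, Finset.mem_image, eq_comm (a := b)]
  · have : ∀ c ∈ blocks l, ¬ InBlock g c := by push Not at h; exact h
    simp only [Finset.mem_union, Finset.mem_image, Finset.mem_singleton, eq_comm (a := b),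
      and_iff_left this]

theorem card_blocks_insertString (hk : 0 < k) (hg : g ≤ l.length) (ha : a ∉ l)
    (h : DisjointBlocks l) :
    (blocks (insertString k a g l)).card =
      (blocks l).card + if gapRank l g = (blocks l).card then 1 else 0 := by
  rw [blocks_insertString hk hg ha]
  by_cases hin : ∃ c ∈ blocks l, InBlock g c
  · rw [if_pos hin, Finset.union_empty, Finset.card_image_of_injective _ (shiftBlock_injective k g)]
    obtain ⟨c, hc, hgc⟩ := hin
    rw [gapRank_of_inBlock h hc hgc, if_neg (labelRank_lt hc).ne, add_zero]
  · rw [if_neg hin]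
    push Not at hin
    rw [gapRank_of_not_inBlock hin, if_pos rfl, Finset.card_union_of_disjoint,
      Finset.card_image_of_injective _ (shiftBlock_injective k g), Finset.card_singleton]
    rw [Finset.disjoint_singleton_right, Finset.mem_image]
    rintro ⟨c, -, hc⟩
    simp only [shiftBlock, Prod.mk.injEq, shiftPos] at hc
    split_ifs at hc <;> omega

theorem DisjointBlocks.insertString (hk : 0 < k) (hg : g ≤ l.length) (ha : a ∉ l)
    (h : DisjointBlocks l) : DisjointBlocks (insertString k a g l) := by
  have hm := shiftPos_strictMono k g
  have hnew : ∀ c ∈ blocks l, ¬ InBlock g c →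
      (shiftBlock k g c).2 < g ∨ g + k - 1 < (shiftBlock k g c).1 := by
    intro c hc hgc
    have := (mem_blocks.1 hc).1.1
    simp only [shiftBlock, InBlock, shiftPos] at hgc ⊢
    split_ifs <;> omega
  intro b hb c hc hne
  rw [mem_blocks_insertString hk hg ha] at hb hc
  rcases hb with ⟨b, hb, rfl⟩ | ⟨rfl, hno⟩ <;> rcases hc with ⟨c, hc, rfl⟩ | ⟨rfl, hno'⟩
  · exact (h b hb c hc (fun e => hne (e ▸ rfl))).imp (fun h => hm h) (fun h => hm h)
  · exact hnew b hb (hno' b hb)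
  · exact (hnew c hc (hno c hc)).symm
  · exact absurd rfl hne

/-- Adding a string of `k` new largest letters adds `k` to one entry of the sequence of block sizes
in the order of the labels. -/
theorem labelBlockSize_insertString (hk : 0 < k) (hg : g ≤ l.length) (ha : ∀ b ∈ l, b < a)
    (h : DisjointBlocks l) (i : ℕ) :
    labelBlockSize (insertString k a g l) i =
      labelBlockSize l i + if gapRank l g = i then k else 0 := by
  have ha' : a ∉ l := fun h => lt_irrefl _ (ha a h)
  rcases lt_or_ge i (blocks l).card with hi | hi
  · obtain ⟨b, hb, rfl⟩ := exists_labelRank_eq hi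
    have hb' : shiftBlock k g b ∈ blocks (_root_.insertString k a g l) :=
      (mem_blocks_insertString hk hg ha' _).2 (.inl ⟨b, hb, rfl⟩)
    rw [← labelRank_shiftBlock hk hg ha hb, labelBlockSize_labelRank hb',
      labelRank_shiftBlock hk hg ha hb, labelBlockSize_labelRank hb,
      blockSize_shiftBlock (mem_blocks.1 hb).1.1]
    congr 1
    by_cases hin : ∃ c ∈ blocks l, InBlock g c
    · obtain ⟨c, hc, hgc⟩ := hin
      rw [gapRank_of_inBlock h hc hgc]
      refine if_congr ⟨fun hgb => by rw [h.eq_of_inBlock hb hc hgb hgc], fun e => ?_⟩ rfl rfl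
      rwa [← labelRank_injOn l hc hb e]
    · push Not at hin
      rw [gapRank_of_not_inBlock hin, if_neg (hin b hb), if_neg hi.ne']
  · rw [labelBlockSize_eq_zero hi, zero_add]
    by_cases hin : gapRank l g = (blocks l).card
    · have hno : ∀ c ∈ blocks l, ¬ InBlock g c := by
        intro c hc hgc
        rw [gapRank_of_inBlock h hc hgc] at hin
        exact (labelRank_lt hc).ne hin
      rcases hi.eq_or_lt with rfl | hi'
      · rw [if_pos hin, ← labelRank_new hk hg ha, labelBlockSize_labelRank
          ((mem_blocks_insertString hk hg ha' _).2 (.inr ⟨rfl, hno⟩))]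
        simp only [blockSize]
        omega
      · rw [if_neg (by omega), labelBlockSize_eq_zero]
        rw [card_blocks_insertString hk hg ha' h, if_pos hin]
        omega
    · have := gapRank_le l g
      rw [if_neg (by omega), labelBlockSize_eq_zero]
      rw [card_blocks_insertString hk hg ha' h, if_neg hin]
      omega

end Insert

/-- The properties that hold for all words obtained from the empty word by adding the strings
`1^k, …, n^k` one after the other. -/
structure IsGrown (k n : ℕ) (l : List ℕ) : Prop where
  length_eq : l.length = k * n
  le : ∀ a ∈ l, a ≤ n
  disjointBlocks : DisjointBlocks l
  le_labelBlockSize : ∀ i < (blocks l).card, k ≤ labelBlockSize l i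
  sum_eq : ∑ i ∈ Finset.range (blocks l).card, labelBlockSize l i = l.length

theorem isGrown_nil (k : ℕ) : IsGrown k 0 [] where
  length_eq := by simp
  le := by simp
  disjointBlocks := by simp [DisjointBlocks, blocks]
  le_labelBlockSize := by simp [blocks]
  sum_eq := by simp [blocks]

theorem IsGrown.sum_of_card_le {k n : ℕ} {l : List ℕ} (h : IsGrown k n l) {m : ℕ}
    (hm : (blocks l).card ≤ m) : ∑ i ∈ Finset.range m, labelBlockSize l i = l.length := by
  rw [← h.sum_eq]
  symm
  refine Finset.sum_subset (by simpa using hm) fun i _ hi => labelBlockSize_eq_zero ?_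
  simpa using hi

theorem IsGrown.sum_le {k n : ℕ} {l : List ℕ} (h : IsGrown k n l) (m : ℕ) :
    ∑ i ∈ Finset.range m, labelBlockSize l i ≤ l.length := by
  rw [← h.sum_of_card_le (le_max_left (blocks l).card m)]
  exact Finset.sum_le_sum_of_subset (by simp)

theorem IsGrown.insertString {k n : ℕ} {l : List ℕ} (hk : 0 < k) (h : IsGrown k n l) {g : ℕ}
    (hg : g ≤ l.length) : IsGrown k (n + 1) (insertString k (n + 1) g l) := by
  have ha : ∀ b ∈ l, b < n + 1 := fun b hb => Nat.lt_succ_of_le (h.le b hb)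
  have ha' : n + 1 ∉ l := fun h => lt_irrefl _ (ha _ h)
  have hr := gapRank_le l g
  refine ⟨?_, ?_, h.disjointBlocks.insertString hk hg ha', ?_, ?_⟩
  · rw [length_insertString hg, h.length_eq, mul_add, mul_one]
  · intro b hb
    simp only [_root_.insertString, List.mem_append, List.mem_replicate] at hb
    rcases hb with (hm | hm) | hm
    · exact (ha _ (List.mem_of_mem_take hm)).le
    · exact hm.2.le
    · exact (ha _ (List.mem_of_mem_drop hm)).le
  · intro i hi
    rw [card_blocks_insertString hk hg ha' h.disjointBlocks] at hi
    rw [labelBlockSize_insertString hk hg ha h.disjointBlocks]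
    rcases lt_or_ge i (blocks l).card with h1 | h1
    · exact (h.le_labelBlockSize i h1).trans (Nat.le_add_right _ _)
    · split_ifs at hi ⊢ <;> omega
  · rw [length_insertString hg]
    simp_rw [labelBlockSize_insertString hk hg ha h.disjointBlocks]
    rw [Finset.sum_add_distrib, h.sum_of_card_le, Finset.sum_ite_eq, if_pos]
    · rw [Finset.mem_range, card_blocks_insertString hk hg ha' h.disjointBlocks]
      split_ifs <;> omega
    · rw [card_blocks_insertString hk hg ha' h.disjointBlocks]
      omega

/-! ### Decreasing rearrangements -/

theorem bddBelow_decreasingRearrangement (x : ℕ → ℝ) (i : ℕ) :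
    BddBelow {t : ℝ | 0 ≤ t ∧ {j : ℕ | t < x j}.encard ≤ i} := ⟨0, fun _ h => h.1⟩

theorem nonempty_decreasingRearrangement {x : ℕ → ℝ} (hx : BddAbove (Set.range x)) (i : ℕ) :
    {t : ℝ | 0 ≤ t ∧ {j : ℕ | t < x j}.encard ≤ i}.Nonempty := by
  obtain ⟨M, hM⟩ := hx
  refine ⟨max M 0, le_max_right _ _, ?_⟩
  have : {j : ℕ | max M 0 < x j} = ∅ := by
    ext j
    simp only [Set.mem_ofPred_eq, Set.mem_empty_iff_false, iff_false, not_lt]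
    exact (hM ⟨j, rfl⟩).trans (le_max_left _ _)
  rw [this]
  simp

theorem decreasingRearrangement_nonneg (x : ℕ → ℝ) (i : ℕ) : 0 ≤ decreasingRearrangement x i :=
  Real.sInf_nonneg fun _ h => h.1

theorem antitone_decreasingRearrangement {x : ℕ → ℝ} (hx : BddAbove (Set.range x)) :
    Antitone (decreasingRearrangement x) := by
  intro i j hij
  refine csInf_le_csInf (bddBelow_decreasingRearrangement x j)
    (nonempty_decreasingRearrangement hx i) fun t ht => ⟨ht.1, ht.2.trans ?_⟩
  exact_mod_cast hij

theorem lt_decreasingRearrangement_iff {x : ℕ → ℝ} (hx : BddAbove (Set.range x)) {t : ℝ}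
    (ht : 0 ≤ t) (i : ℕ) : t < decreasingRearrangement x i ↔ i < {j : ℕ | t < x j}.encard := by
  rw [← not_le (a := {j : ℕ | t < x j}.encard)]
  constructor
  · exact fun h h' => (csInf_le (bddBelow_decreasingRearrangement x i) ⟨ht, h'⟩).not_gt h
  · intro h
    rw [not_le] at h
    -- `i + 1` terms exceed `t`, hence they exceed some `s > t`
    obtain ⟨r, hr, hr'⟩ := Set.exists_subset_encard_eq (Order.add_one_le_of_lt h)
    have hf : r.Finite := Set.finite_of_encard_eq_coe (k := i + 1) (by exact_mod_cast hr')
    have hne : hf.toFinset.Nonempty := by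
      rw [hf.toFinset_nonempty, ← Set.encard_ne_zero, hr']
      simp
    obtain ⟨m, hm, hmin⟩ := hf.toFinset.exists_min_image x hne
    refine (hr (hf.mem_toFinset.1 hm) : t < x m).trans_le
      (le_csInf (nonempty_decreasingRearrangement hx i) fun s hs => ?_)
    by_contra hsm
    have : r ⊆ {j : ℕ | s < x j} := fun j hj =>
      (not_le.1 hsm).trans_le (hmin j (hf.mem_toFinset.2 hj))
    have := (Set.encard_le_encard this).trans hs.2
    rw [hr'] at this
    exact absurd this (by exact_mod_cast Nat.not_succ_le_self i)

theorem decreasingRearrangement_le_add {x y : ℕ → ℝ} (hy : BddAbove (Set.range y)) {ε : ℝ}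
    (hε : 0 ≤ ε) (h : ∀ j, x j ≤ y j + ε) (i : ℕ) :
    decreasingRearrangement x i ≤ decreasingRearrangement y i + ε := by
  rw [← sub_le_iff_le_add]
  refine le_csInf (nonempty_decreasingRearrangement hy i) fun s hs => ?_
  rw [sub_le_iff_le_add]
  refine csInf_le (bddBelow_decreasingRearrangement x i) ⟨by linarith [hs.1], ?_⟩
  refine (Set.encard_le_encard fun j (hj : s + ε < x j) => ?_).trans hs.2
  have := h j
  show s < y j
  linarith

theorem abs_decreasingRearrangement_sub_le {x y : ℕ → ℝ} (hx : BddAbove (Set.range x))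
    (hy : BddAbove (Set.range y)) {ε : ℝ} (h : ∀ j, |x j - y j| ≤ ε) (i : ℕ) :
    |decreasingRearrangement x i - decreasingRearrangement y i| ≤ ε := by
  have hε : 0 ≤ ε := (abs_nonneg _).trans (h 0)
  rw [abs_sub_le_iff]
  constructor
  · have := decreasingRearrangement_le_add hy hε
      (fun j => by linarith [(abs_le.1 (h j)).2] : ∀ j, x j ≤ y j + ε) i
    linarith
  · have := decreasingRearrangement_le_add hx hε
      (fun j => by linarith [(abs_le.1 (h j)).1] : ∀ j, y j ≤ x j + ε) i
    linarith

theorem Summable.bddAbove_range {x : ℕ → ℝ} (hx : Summable x) : BddAbove (Set.range x) :=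
  hx.tendsto_atTop_zero.bddAbove_range

theorem encard_lt_decreasingRearrangement {x : ℕ → ℝ} (hx : BddAbove (Set.range x)) {t : ℝ}
    (ht : 0 ≤ t) : {i : ℕ | t < decreasingRearrangement x i}.encard = {j : ℕ | t < x j}.encard := by
  simp_rw [lt_decreasingRearrangement_iff hx ht]
  generalize {j : ℕ | t < x j}.encard = N
  induction N using ENat.recTopCoe with
  | top =>
    have : {i : ℕ | (i : ℕ∞) < ⊤} = Set.univ := by ext; simp
    rw [this, Set.encard_univ]
    simp
  | coe n =>
    have : {i : ℕ | (i : ℕ∞) < n} = (Finset.range n : Set ℕ) := by ext; simp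
    rw [this, Set.encard_coe_eq_coe_finsetCard]
    simp

/-- The layer cake formula for a sum. -/
theorem tsum_ofReal_eq_lintegral_encard (x : ℕ → ℝ) :
    ∑' j, ENNReal.ofReal (x j) =
      ∫⁻ t in Set.Ioi (0 : ℝ), (({j : ℕ | t < x j}.encard : ℕ∞) : ENNReal) := by
  have h1 : ∀ j, ENNReal.ofReal (x j) =
      ∫⁻ t in Set.Ioi (0 : ℝ), (Set.Iio (x j)).indicator (fun _ => 1) t := by
    intro j
    rw [lintegral_indicator measurableSet_Iio, setLIntegral_one,
      Measure.restrict_apply measurableSet_Iio, Set.inter_comm, Set.Ioi_inter_Iio, Real.volume_Ioo,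
      sub_zero]
  simp_rw [h1]
  rw [← lintegral_tsum fun j =>
    ((measurable_const (a := (1 : ENNReal))).indicator measurableSet_Iio).aemeasurable]
  congr 1
  ext t
  rw [← ENNReal.tsum_set_one, tsum_subtype {j : ℕ | t < x j} fun _ => (1 : ENNReal)]
  rfl

/-- The sum of a non-negative sequence is the integral over `t > 0` of the number of terms that
exceed `t`, and these numbers do not change under rearrangement. -/
theorem HasSum.decreasingRearrangement {x : ℕ → ℝ} {S : ℝ} (hx : HasSum x S) (h0 : ∀ j, 0 ≤ x j) :
    HasSum (decreasingRearrangement x) S := by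
  have hb := hx.summable.bddAbove_range
  have h1 : ∑' i, ENNReal.ofReal (_root_.decreasingRearrangement x i) =
      ∑' j, ENNReal.ofReal (x j) := by
    rw [tsum_ofReal_eq_lintegral_encard, tsum_ofReal_eq_lintegral_encard]
    refine setLIntegral_congr_fun measurableSet_Ioi fun t ht => ?_
    rw [encard_lt_decreasingRearrangement hb (le_of_lt ht)]
  have h2 : ∑' j, ENNReal.ofReal (x j) = ENNReal.ofReal S := by
    rw [← ENNReal.ofReal_tsum_of_nonneg h0 hx.summable, hx.tsum_eq]
  have hs : Summable (_root_.decreasingRearrangement x) := by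
    have := ENNReal.summable_toReal (f := fun i =>
      ENNReal.ofReal (_root_.decreasingRearrangement x i)) (by rw [h1, h2]; simp)
    simpa [ENNReal.toReal_ofReal (decreasingRearrangement_nonneg x _)] using this
  rw [hs.hasSum_iff]
  rw [← ENNReal.ofReal_tsum_of_nonneg (decreasingRearrangement_nonneg x) hs] at h1
  rw [← ENNReal.ofReal_eq_ofReal_iff (tsum_nonneg (decreasingRearrangement_nonneg x))
    (hx.nonneg h0), h1, h2]

/-- **Scheffé's lemma** for sequences. -/
theorem tendsto_tsum_abs_sub {x : ℕ → ℕ → ℝ} {y : ℕ → ℝ} {S : ℝ}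
    (hx : ∀ᶠ n in atTop, HasSum (x n) S) (hx0 : ∀ n i, 0 ≤ x n i) (hy : HasSum y S)
    (hy0 : ∀ i, 0 ≤ y i) (h : ∀ i, Tendsto (fun n => x n i) atTop (𝓝 (y i))) :
    Tendsto (fun n => ∑' i, |x n i - y i|) atTop (𝓝 0) := by
  have h1 : Tendsto (fun n => ∑' i, max (y i - x n i) 0) atTop (𝓝 (∑' _ : ℕ, 0)) := by
    refine tendsto_tsum_of_dominated_convergence hy.summable (fun i => ?_)
      (Eventually.of_forall fun n i => ?_)
    · have := ((h i).const_sub (y i)).max (tendsto_const_nhds (x := (0 : ℝ)))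
      simpa using this
    · rw [Real.norm_of_nonneg (le_max_right _ _)]
      exact max_le (by linarith [hx0 n i]) (hy0 i)
  rw [tsum_zero] at h1
  have h2 := h1.const_mul 2
  rw [mul_zero] at h2
  refine h2.congr' ?_
  filter_upwards [hx] with n hn
  have hd : HasSum (fun i => x n i - y i) 0 := by simpa using hn.sub hy
  have hm : Summable fun i => max (y i - x n i) 0 :=
    Summable.of_nonneg_of_le (fun i => le_max_right _ _)
      (fun i => max_le (by linarith [hx0 n i]) (hy0 i)) hy.summable
  have hsum := hd.summable.tsum_add (hm.mul_left 2)
  rw [hd.tsum_eq, zero_add, tsum_mul_left] at hsum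
  rw [← hsum]
  refine tsum_congr fun i => ?_
  rcases le_total (x n i) (y i) with hle | hle
  · rw [abs_of_nonpos (by linarith), max_eq_left (by linarith)]; ring
  · rw [abs_of_nonneg (by linarith), max_eq_right (by linarith)]; ring

/-- If sequences converge in `ℓ¹`, so do the terms of their decreasing rearrangements. -/
theorem tendsto_decreasingRearrangement {x : ℕ → ℕ → ℝ} {y : ℕ → ℝ}
    (hx : ∀ᶠ n in atTop, Summable (x n)) (hy : Summable y)
    (h : Tendsto (fun n => ∑' i, |x n i - y i|) atTop (𝓝 0)) (i : ℕ) :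
    Tendsto (fun n => decreasingRearrangement (x n) i) atTop
      (𝓝 (decreasingRearrangement y i)) := by
  rw [tendsto_iff_dist_tendsto_zero]
  refine squeeze_zero' (Eventually.of_forall fun n => dist_nonneg) ?_ h
  filter_upwards [hx] with n hn
  exact abs_decreasingRearrangement_sub_le hn.bddAbove_range hy.bddAbove_range
    (fun j => (hn.sub hy).abs.le_tsum j fun _ _ => abs_nonneg _) i

/-- The first term of the decreasing rearrangement is the greatest term. -/
theorem isGreatest_decreasingRearrangement_zero {x : ℕ → ℝ} (hx : Summable x)
    (hpos : ∃ j, 0 < x j) :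
    IsGreatest (Set.range x) (decreasingRearrangement x 0) := by
  have hb := hx.bddAbove_range
  have key : ∀ j, 0 ≤ x j → x j ≤ decreasingRearrangement x 0 := by
    intro j hj
    refine le_csInf (nonempty_decreasingRearrangement hb 0) fun t ht => ?_
    by_contra hlt
    have := ht.2
    simp only [CharP.cast_eq_zero, nonpos_iff_eq_zero, Set.encard_eq_zero] at this
    exact (Set.eq_empty_iff_forall_notMem.1 this j) (not_le.1 hlt)
  obtain ⟨j, hj⟩ := hpos
  have hlt : 0 < decreasingRearrangement x 0 := hj.trans_le (key j hj.le)
  refine ⟨?_, ?_⟩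
  · by_contra hM
    -- only finitely many terms exceed half the supremum, and none of them attains it
    set M := decreasingRearrangement x 0 with hMd
    have hfin : {j | M / 2 < x j}.Finite := by
      have := hx.tendsto_atTop_zero.eventually (gt_mem_nhds (half_pos hlt))
      rw [← Nat.cofinite_eq_atTop, eventually_cofinite] at this
      exact this.subset fun j hj => not_lt.2 (le_of_lt hj)
    have hne : hfin.toFinset.Nonempty := by
      have h1 := (lt_decreasingRearrangement_iff hb (half_pos hlt).le 0).1
        (by rw [← hMd]; linarith)
      rw [Nat.cast_zero, Set.encard_pos] at h1
      exact hfin.toFinset_nonempty.2 h1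
    obtain ⟨m, hm, hmax⟩ := hfin.toFinset.exists_max_image x hne
    have hm' : M / 2 < x m := hfin.mem_toFinset.1 hm
    have hmM : x m < M := lt_of_le_of_ne (key m (by linarith)) fun e => hM ⟨m, e⟩
    have h1 := (lt_decreasingRearrangement_iff hb (by linarith) 0).1 (hMd ▸ hmM)
    rw [Nat.cast_zero, Set.encard_pos] at h1
    obtain ⟨j, hj⟩ := h1
    have hj' : x m < x j := hj
    exact (hmax j (hfin.mem_toFinset.2 (hm'.trans hj'))).not_gt hj'
  · rintro _ ⟨j, rfl⟩
    rcases le_total 0 (x j) with h | h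
    · exact key j h
    · exact h.trans hlt.le

/-! ### Sorted block sizes -/

theorem lt_getD_iff_lt_countP {L : List ℕ} (hL : L.Pairwise (· ≥ ·)) {t : ℝ} (ht : 0 ≤ t) (i : ℕ) :
    t < (L.getD i 0 : ℕ) ↔ i < L.countP fun s : ℕ => t < (s : ℝ) := by
  induction L generalizing i with
  | nil => simp [ht]
  | cons a L ih =>
    rw [List.pairwise_cons] at hL
    have h0 : ¬ t < (a : ℝ) → L.countP (fun s : ℕ => t < (s : ℝ)) = 0 := by
      intro h
      rw [List.countP_eq_zero]
      intro s hs
      have : (s : ℝ) ≤ a := by exact_mod_cast hL.1 s hs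
      simpa using this.trans (not_lt.1 h)
    by_cases h : t < (a : ℝ)
    · rw [List.countP_cons_of_pos (by simpa using h)]
      cases i with
      | zero => simpa using h
      | succ i => rw [List.getD_cons_succ, ih hL.2]; omega
    · rw [List.countP_cons_of_neg (by simpa using h), h0 h]
      cases i with
      | zero => simpa using h
      | succ i => rw [List.getD_cons_succ, ih hL.2, h0 h]; omega

theorem lt_sortedBlockSize_iff (l : List ℕ) {t : ℝ} (ht : 0 ≤ t) (i : ℕ) :
    t < sortedBlockSize l i ↔ i < ((blocks l).filter fun b => t < (blockSize b : ℝ)).card := by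
  unfold sortedBlockSize
  rw [lt_getD_iff_lt_countP (Multiset.pairwise_sort _ _) ht, ← Multiset.coe_countP,
    Multiset.sort_eq, Multiset.countP_map]
  rfl

theorem encard_lt_labelBlockSize (l : List ℕ) {t : ℝ} (ht : 0 ≤ t) :
    {j : ℕ | t < (labelBlockSize l j : ℝ)}.encard =
      ((blocks l).filter fun b => t < (blockSize b : ℝ)).card := by
  have : {j : ℕ | t < (labelBlockSize l j : ℝ)} =
      (((blocks l).filter fun b => t < (blockSize b : ℝ)).image (labelRank l) : Finset ℕ) := by
    ext j
    simp only [Set.mem_ofPred_eq, Finset.coe_image, Set.mem_image, Finset.mem_coe,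
      Finset.mem_filter]
    constructor
    · intro h
      have hj : j < (blocks l).card := by
        by_contra hj
        rw [labelBlockSize_eq_zero (not_lt.1 hj), Nat.cast_zero] at h
        exact h.not_ge ht
      obtain ⟨b, hb, rfl⟩ := exists_labelRank_eq hj
      rw [labelBlockSize_labelRank hb] at h
      exact ⟨b, ⟨hb, h⟩, rfl⟩
    · rintro ⟨b, ⟨hb, h⟩, rfl⟩
      rwa [labelBlockSize_labelRank hb]
  rw [this, Set.encard_coe_eq_coe_finsetCard, Finset.card_image_of_injOn]
  exact (labelRank_injOn l).mono fun b hb => (Finset.mem_filter.1 hb).1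

theorem summable_labelBlockSize_div (l : List ℕ) (c : ℝ) :
    Summable fun j => (labelBlockSize l j : ℝ) / c :=
  summable_of_ne_finset_zero (s := Finset.range (blocks l).card) fun j hj => by
    rw [labelBlockSize_eq_zero (by simpa using hj)]
    simp

theorem sortedBlockSize_div_eq (l : List ℕ) {c : ℝ} (hc : 0 < c) (i : ℕ) :
    (sortedBlockSize l i : ℝ) / c =
      decreasingRearrangement (fun j => (labelBlockSize l j : ℝ) / c) i := by
  have key : ∀ t : ℝ, 0 ≤ t → (t < (sortedBlockSize l i : ℝ) / c ↔
      t < decreasingRearrangement (fun j => (labelBlockSize l j : ℝ) / c) i) := by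
    intro t ht
    rw [lt_decreasingRearrangement_iff (summable_labelBlockSize_div l c).bddAbove_range ht,
      lt_div_iff₀ hc, lt_sortedBlockSize_iff l (by positivity)]
    simp_rw [lt_div_iff₀ hc]
    rw [encard_lt_labelBlockSize l (by positivity)]
    norm_cast
  have h1 : 0 ≤ (sortedBlockSize l i : ℝ) / c := by positivity
  have h2 := decreasingRearrangement_nonneg (fun j => (labelBlockSize l j : ℝ) / c) i
  refine le_antisymm ?_ ?_
  · by_contra h
    exact lt_irrefl _ ((key _ h2).1 (not_le.1 h))
  · by_contra h
    exact lt_irrefl _ ((key _ h1).2 (not_le.1 h))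

theorem IsGrown.hasSum_labelBlockSize {k n : ℕ} {l : List ℕ} (h : IsGrown k n l)
    (hkn : (0 : ℝ) < (k : ℝ) * n) :
    HasSum (fun j => (labelBlockSize l j : ℝ) / ((k : ℝ) * n)) 1 := by
  have := hasSum_sum_of_ne_finset_zero (L := .unconditional ℕ) (s := Finset.range (blocks l).card)
    (f := fun j => (labelBlockSize l j : ℝ) / ((k : ℝ) * n)) fun j hj => by
      rw [labelBlockSize_eq_zero (by simpa using hj)]
      simp
  rwa [← Finset.sum_div, ← Nat.cast_sum, h.sum_eq, h.length_eq, Nat.cast_mul,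
    div_self hkn.ne'] at this

/-! ### Pólya urns and moments of the beta distribution -/

/-- A Pólya urn with weights `C` and `D`, in which the weight of the drawn colour grows by `k`,
has a limiting fraction `x` of weight of the first colour; this is the expectation of `P x`. -/
noncomputable def urnMoment (k : ℝ) (P : Polynomial ℝ) (C D : ℝ) : ℝ :=
  ∑ j ∈ Finset.range (P.natDegree + 1),
    P.coeff j * ∏ t ∈ Finset.range j, (C + t * k) / (C + D + t * k)

/-- The case of a monomial in `urnMoment_step`. -/
theorem prod_urn_step {k C D : ℝ} (hk : 0 < k) (hC : 0 < C) (hD : 0 < D) (j : ℕ) :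
    C * ∏ t ∈ Finset.range j, (C + k + t * k) / (C + k + D + t * k) +
      D * ∏ t ∈ Finset.range j, (C + t * k) / (C + (D + k) + t * k) =
      (C + D) * ∏ t ∈ Finset.range j, (C + t * k) / (C + D + t * k) := by
  have shift : ∀ S : ℝ, S * ∏ t ∈ Finset.range j, (S + k + t * k) =
      (∏ t ∈ Finset.range j, (S + t * k)) * (S + j * k) := by
    intro S
    rw [← Finset.prod_range_succ (fun t : ℕ => S + t * k), Finset.prod_range_succ', mul_comm]
    congr 1
    · refine Finset.prod_congr rfl fun t _ => ?_
      push_cast; ring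
    · simp
  have e1 : ∀ t : ℕ, C + k + D + t * k = C + D + k + t * k := fun t => by ring
  have e2 : ∀ t : ℕ, C + (D + k) + t * k = C + D + k + t * k := fun t => by ring
  simp_rw [e1, e2, Finset.prod_div_distrib]
  have hpos : ∀ S : ℝ, 0 < S → 0 < ∏ t ∈ Finset.range j, (S + t * k) :=
    fun S hS => Finset.prod_pos fun t _ => by positivity
  have h1 := hpos (C + D) (by positivity)
  have h2 := hpos (C + D + k) (by positivity)
  have sC := shift C
  have sS := shift (C + D)
  set A := ∏ t ∈ Finset.range j, (C + t * k)
  set A' := ∏ t ∈ Finset.range j, (C + k + t * k)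
  set B := ∏ t ∈ Finset.range j, (C + D + t * k)
  set B' := ∏ t ∈ Finset.range j, (C + D + k + t * k)
  have hS : C * A' + D * A = A * (C + D + j * k) := by rw [sC]; ring
  rw [← mul_div_assoc, ← mul_div_assoc, ← mul_div_assoc, ← add_div, hS,
    div_eq_div_iff h2.ne' h1.ne']
  linear_combination (-A) * sS

/-- The value `urnMoment k P C D` is the mean of its values after the next draw. -/
theorem urnMoment_step {k C D : ℝ} (hk : 0 < k) (hC : 0 < C) (hD : 0 < D) (P : Polynomial ℝ) :
    C * urnMoment k P (C + k) D + D * urnMoment k P C (D + k) =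
      (C + D) * urnMoment k P C D := by
  simp only [urnMoment, Finset.mul_sum]
  rw [← Finset.sum_add_distrib]
  refine Finset.sum_congr rfl fun j _ => ?_
  linear_combination P.coeff j * prod_urn_step hk hC hD j

theorem abs_urnMoment_le {k C D : ℝ} (hk : 0 < k) (hC : 0 < C) (hD : 0 < D) (P : Polynomial ℝ) :
    |urnMoment k P C D| ≤ ∑ j ∈ Finset.range (P.natDegree + 1), |P.coeff j| := by
  refine (Finset.abs_sum_le_sum_abs _ _).trans (Finset.sum_le_sum fun j _ => ?_)
  rw [abs_mul, Finset.abs_prod]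
  refine mul_le_of_le_one_right (abs_nonneg _) (Finset.prod_le_one (fun _ _ => abs_nonneg _) ?_)
  intro t _
  have : 0 ≤ (t : ℝ) * k := by positivity
  rw [abs_of_nonneg (by positivity), div_le_one (by positivity)]
  linarith

theorem tendsto_urnMoment {ι : Type*} {f : Filter ι} {k x : ℝ} (P : Polynomial ℝ) {C D : ι → ℝ}
    (hS : Tendsto (fun n => C n + D n) f atTop)
    (hx : Tendsto (fun n => C n / (C n + D n)) f (𝓝 x)) :
    Tendsto (fun n => urnMoment k P (C n) (D n)) f (𝓝 (P.eval x)) := by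
  rw [Polynomial.eval_eq_sum_range]
  refine tendsto_finsetSum _ fun j _ => Tendsto.const_mul _ ?_
  have : x ^ j = ∏ _t ∈ Finset.range j, x := by simp
  rw [this]
  refine tendsto_finsetProd _ fun t _ => ?_
  have h0 : Tendsto (fun n => (t * k) / (C n + D n)) f (𝓝 0) := hS.const_div_atTop _
  have h1 := (hx.add h0).div (h0.const_add 1) (by simp)
  rw [add_zero, add_zero, div_one] at h1
  refine h1.congr' ?_
  filter_upwards [hS.eventually_gt_atTop 0] with n hn
  simp only [Pi.div_apply]
  rw [← add_div, one_add_div hn.ne', div_div_div_cancel_right₀ hn.ne']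

theorem integral_betaMeasure (a b : ℝ) (f : ℝ → ℝ) :
    ∫ x, f x ∂betaMeasure a b = ∫ x, (betaPDF a b x).toReal * f x := by
  unfold betaMeasure
  rw [integral_withDensity_eq_integral_toReal_smul]
  · rfl
  · exact (measurable_betaPDFReal a b).ennreal_ofReal
  · exact Eventually.of_forall fun x => ENNReal.ofReal_lt_top

theorem betaPDFReal_mul {a b : ℝ} (ha : 0 < a) (hb : 0 < b) (x : ℝ) :
    betaPDFReal a b x * x = a / (a + b) * betaPDFReal (a + 1) b x := by
  unfold betaPDFReal
  split_ifs with hx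
  · have h1 : x ^ (a + 1 - 1) = x ^ (a - 1) * x := by
      rw [← Real.rpow_add_one hx.1.ne']; congr 1; ring
    have h2 : beta (a + 1) b = beta a b * (a / (a + b)) := by
      unfold beta
      rw [Real.Gamma_add_one ha.ne', show a + 1 + b = a + b + 1 by ring,
        Real.Gamma_add_one (by positivity)]
      have := (Real.Gamma_pos_of_pos (show 0 < a + b by positivity)).ne'
      field_simp
    have h3 := (beta_pos ha hb).ne'
    rw [h1, h2]
    field_simp
  · simp

theorem integral_pow_betaMeasure {a b : ℝ} (ha : 0 < a) (hb : 0 < b) (j : ℕ) :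
    ∫ x, x ^ j ∂betaMeasure a b = ∏ t ∈ Finset.range j, (a + t) / (a + b + t) := by
  induction j generalizing a with
  | zero =>
    have := isProbabilityMeasureBeta ha hb
    simp
  | succ j ih =>
    have hn : ∀ a' x, 0 < a' → (betaPDF a' b x).toReal = betaPDFReal a' b x := by
      intro a' x ha'
      refine ENNReal.toReal_ofReal ?_
      by_cases hx : 0 < x ∧ x < 1
      · exact (betaPDFReal_pos hx.1 hx.2 ha' hb).le
      · rw [betaPDFReal, if_neg hx]
    have : ∀ x, (betaPDF a b x).toReal * x ^ (j + 1) =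
        a / (a + b) * ((betaPDF (a + 1) b x).toReal * x ^ j) := by
      intro x
      rw [hn a x ha, hn (a + 1) x (by positivity), pow_succ', ← mul_assoc, betaPDFReal_mul ha hb,
        mul_assoc]
    rw [integral_betaMeasure]
    simp_rw [this]
    rw [integral_const_mul, ← integral_betaMeasure, ih (by positivity), Finset.prod_range_succ',
      mul_comm]
    congr 1
    · refine Finset.prod_congr rfl fun t _ => ?_
      push_cast
      congr 1 <;> ring
    · simp

theorem ae_betaMeasure_mem_Ioo (a b : ℝ) : ∀ᵐ x ∂betaMeasure a b, x ∈ Set.Ioo (0 : ℝ) 1 := by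
  have hm : Measurable (betaPDF a b) := (measurable_betaPDFReal a b).ennreal_ofReal
  unfold betaMeasure
  rw [ae_withDensity_iff hm]
  refine Eventually.of_forall fun x hx => ?_
  by_contra h
  rcases not_and_or.1 h with h | h
  · exact hx (betaPDF_eq_zero_of_nonpos (not_lt.1 h))
  · exact hx (betaPDF_eq_zero_of_one_le (not_lt.1 h))

theorem integrable_betaMeasure_of_continuous {a b : ℝ} (ha : 0 < a) (hb : 0 < b) {f : ℝ → ℝ}
    (hf : Continuous f) : Integrable f (betaMeasure a b) := by
  have := isProbabilityMeasureBeta ha hb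
  obtain ⟨M, hM⟩ := isCompact_Icc.exists_bound_of_continuousOn (s := Set.Icc (0 : ℝ) 1)
    hf.continuousOn
  refine Integrable.of_bound hf.aestronglyMeasurable M ?_
  filter_upwards [ae_betaMeasure_mem_Ioo a b] with x hx
  exact hM x ⟨hx.1.le, hx.2.le⟩

theorem urnMoment_eq_integral {k C D : ℝ} (hk : 0 < k) (hC : 0 < C) (hD : 0 < D)
    (P : Polynomial ℝ) :
    urnMoment k P C D = ∫ x, P.eval x ∂betaMeasure (C / k) (D / k) := by
  have hC' : 0 < C / k := by positivity
  have hD' : 0 < D / k := by positivity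
  simp_rw [Polynomial.eval_eq_sum_range]
  rw [integral_finsetSum _ fun j _ => integrable_betaMeasure_of_continuous hC' hD' (by fun_prop)]
  refine Finset.sum_congr rfl fun j _ => ?_
  rw [integral_const_mul, integral_pow_betaMeasure hC' hD']
  congr 1
  refine Finset.prod_congr rfl fun t _ => ?_
  field_simp

/-! ### The urns of the block sizes -/

/-- The weight of block `i` in the urn in which it competes with the blocks of larger label: the
number of its inner gaps, and before it exists the number `k - 1` of those that it will start
with. -/
noncomputable def urnC (k : ℕ) (l : List ℕ) (i : ℕ) : ℝ :=
  ((max (labelBlockSize l i) k : ℕ) : ℝ) - 1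

/-- The weight of the blocks of larger label, present or future, in the urn of block `i`. -/
noncomputable def urnD (l : List ℕ) (i : ℕ) : ℝ :=
  i + 2 + l.length - ∑ j ∈ Finset.range (i + 1), (labelBlockSize l j : ℝ)

theorem urnC_pos {k : ℕ} (hk : 2 ≤ k) (l : List ℕ) (i : ℕ) : 0 < urnC k l i := by
  have : ((2 : ℕ) : ℝ) ≤ (max (labelBlockSize l i) k : ℕ) := by
    exact_mod_cast hk.trans (le_max_right _ _)
  unfold urnC
  push_cast at this ⊢
  linarith

theorem IsGrown.urnD_pos {k n : ℕ} {l : List ℕ} (h : IsGrown k n l) (i : ℕ) : 0 < urnD l i := by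
  have : ((∑ j ∈ Finset.range (i + 1), labelBlockSize l j : ℕ) : ℝ) ≤ l.length := by
    exact_mod_cast h.sum_le (i + 1)
  unfold urnD
  push_cast at this
  have : (0 : ℝ) ≤ i := by positivity
  linarith

section Harmonic

variable {k n : ℕ} {l : List ℕ}

theorem IsGrown.urnC_insertString (hk : 0 < k) (h : IsGrown k n l) {g : ℕ} (hg : g ≤ l.length)
    (i : ℕ) : urnC k (_root_.insertString k (n + 1) g l) i =
      urnC k l i + if gapRank l g = i ∧ i < (blocks l).card then (k : ℝ) else 0 := by
  unfold urnC
  rw [labelBlockSize_insertString hk hg (fun b hb => Nat.lt_succ_of_le (h.le b hb))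
    h.disjointBlocks]
  by_cases hi : i < (blocks l).card
  · have := h.le_labelBlockSize i hi
    rw [max_eq_left (by omega), max_eq_left this]
    simp only [hi, and_true]
    split_ifs <;> push_cast <;> ring
  · rw [labelBlockSize_eq_zero (not_lt.1 hi), if_neg (c := _ ∧ _) (fun h => hi h.2)]
    split_ifs <;> simp

theorem IsGrown.urnD_insertString (hk : 0 < k) (h : IsGrown k n l) {g : ℕ} (hg : g ≤ l.length)
    (i : ℕ) : urnD (_root_.insertString k (n + 1) g l) i =
      urnD l i + if i < gapRank l g then (k : ℝ) else 0 := by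
  unfold urnD
  simp_rw [labelBlockSize_insertString hk hg (fun b hb => Nat.lt_succ_of_le (h.le b hb))
    h.disjointBlocks]
  rw [length_insertString hg]
  push_cast
  rw [Finset.sum_add_distrib, Finset.sum_ite_eq]
  simp only [Finset.mem_range]
  split_ifs <;> first | omega | ring

theorem IsGrown.card_gapRank_eq_urnC (h : IsGrown k n l) {i : ℕ}
    (hi : i < (blocks l).card) :
    (((Finset.range (l.length + 1)).filter fun g => gapRank l g = i).card : ℝ) = urnC k l i := by
  unfold urnC
  rw [max_eq_left (h.le_labelBlockSize i hi), ← card_gapRank_eq h.disjointBlocks hi]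
  push_cast
  ring

/-- The gaps that belong to a block after the block `i`, or to a new block, are those that are left
after the inner gaps of the first `i + 1` blocks; their number is the weight `urnD`. -/
theorem IsGrown.card_gapRank_gt_eq_urnD (h : IsGrown k n l) {i : ℕ}
    (hi : i < (blocks l).card) :
    (((Finset.range (l.length + 1)).filter fun g => i < gapRank l g).card : ℝ) = urnD l i := by
  have h1 := Finset.card_filter_add_card_filter_not (s := Finset.range (l.length + 1))
    (fun g => i < gapRank l g)
  have h2 : ((Finset.range (l.length + 1)).filter fun g => ¬ i < gapRank l g).card =
      ∑ j ∈ Finset.range (i + 1),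
        ((Finset.range (l.length + 1)).filter fun g => gapRank l g = j).card := by
    rw [Finset.card_eq_sum_card_fiberwise (f := gapRank l) (t := Finset.range (i + 1))]
    · refine Finset.sum_congr rfl fun j hj => ?_
      congr 1
      ext g
      have := Finset.mem_range.1 hj
      simp only [Finset.mem_filter]
      constructor
      · exact fun h => ⟨h.1.1, h.2⟩
      · exact fun h => ⟨⟨h.1, by omega⟩, h.2⟩
    · intro g hg
      have := (Finset.mem_filter.1 (Finset.mem_coe.1 hg)).2
      simp only [Finset.coe_range, Set.mem_Iio]
      omega
  have h3 : ∑ j ∈ Finset.range (i + 1),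
        ((Finset.range (l.length + 1)).filter fun g => gapRank l g = j).card + (i + 1) =
      ∑ j ∈ Finset.range (i + 1), labelBlockSize l j := by
    calc _ = ∑ j ∈ Finset.range (i + 1),
          (((Finset.range (l.length + 1)).filter fun g => gapRank l g = j).card + 1) := by
          rw [Finset.sum_add_distrib, Finset.sum_const, Finset.card_range, smul_eq_mul, mul_one]
      _ = _ := Finset.sum_congr rfl fun j hj =>
          card_gapRank_eq h.disjointBlocks (by have := Finset.mem_range.1 hj; omega)
  have h4 : ((Finset.range (l.length + 1)).filter fun g => i < gapRank l g).card +
      ∑ j ∈ Finset.range (i + 1), labelBlockSize l j = l.length + 1 + (i + 1) := by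
    rw [← h3, ← h2, ← add_assoc, h1, Finset.card_range]
  have h5 := congrArg (Nat.cast : ℕ → ℝ) h4
  push_cast at h5
  unfold urnD
  linarith

/-- A product of functions of the first `m` urns, each of which is harmonic for its urn, is
harmonic for the insertion of a string in a uniform gap. -/
theorem IsGrown.sum_prod_urn (hk : 2 ≤ k) (h : IsGrown k n l) (u : ℕ → ℝ → ℝ → ℝ)
    (hu : ∀ i C D, 0 < C → 0 < D → C * u i (C + k) D + D * u i C (D + k) = (C + D) * u i C D)
    (m : ℕ) :
    ∑ g ∈ Finset.range (l.length + 1), ∏ i ∈ Finset.range m,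
        u i (urnC k (_root_.insertString k (n + 1) g l) i)
          (urnD (_root_.insertString k (n + 1) g l) i) =
      (l.length + 1) * ∏ i ∈ Finset.range m, u i (urnC k l i) (urnD l i) := by
  have hk0 : 0 < k := by omega
  induction m with
  | zero => simp
  | succ m ih =>
    rw [Finset.prod_range_succ, ← mul_assoc, ← ih, Finset.sum_mul, ← sub_eq_zero,
      ← Finset.sum_sub_distrib]
    rcases lt_or_ge m (blocks l).card with hm | hm
    · -- the urn of block `m` changes only if no block of smaller label is hit, and in that case
      -- all the urns before it change in the same way
      set H := ∏ i ∈ Finset.range m, u i (urnC k l i) (urnD l i + k)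
      set f := u m (urnC k l m) (urnD l m)
      set f₁ := u m (urnC k l m + k) (urnD l m)
      set f₂ := u m (urnC k l m) (urnD l m + k)
      have key : ∀ g ∈ Finset.range (l.length + 1),
          (∏ i ∈ Finset.range (m + 1), u i (urnC k (_root_.insertString k (n + 1) g l) i)
            (urnD (_root_.insertString k (n + 1) g l) i)) -
          (∏ i ∈ Finset.range m, u i (urnC k (_root_.insertString k (n + 1) g l) i)
            (urnD (_root_.insertString k (n + 1) g l) i)) * f =
          (if gapRank l g = m then H * (f₁ - f) else 0) +
            if m < gapRank l g then H * (f₂ - f) else 0 := by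
        intro g hg
        have hg' : g ≤ l.length := by simpa [Nat.lt_succ_iff] using hg
        rw [Finset.prod_range_succ, ← mul_sub]
        simp_rw [h.urnC_insertString hk0 hg', h.urnD_insertString hk0 hg']
        have hH : m ≤ gapRank l g → ∏ i ∈ Finset.range m,
            u i (urnC k l i + if gapRank l g = i ∧ i < (blocks l).card then (k : ℝ) else 0)
              (urnD l i + if i < gapRank l g then (k : ℝ) else 0) = H := by
          intro hmg
          refine Finset.prod_congr rfl fun i hi => ?_
          have := Finset.mem_range.1 hi
          rw [if_neg (by omega), if_pos (by omega), add_zero]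
        rcases lt_trichotomy (gapRank l g) m with h1 | h1 | h1
        · rw [if_neg (c := gapRank l g = m ∧ _) (by omega), if_neg (c := m < gapRank l g) (by omega),
            if_neg (c := gapRank l g = m) (by omega)]
          simp [f, h1.not_gt]
        · rw [if_pos (c := gapRank l g = m ∧ _) ⟨h1, hm⟩, if_neg (c := m < gapRank l g) (by omega),
            if_pos (c := gapRank l g = m) h1, hH h1.ge]
          simp [f₁, h1.le.not_gt]
        · rw [if_neg (c := gapRank l g = m ∧ _) (by omega), if_pos (c := m < gapRank l g) h1,
            if_neg (c := gapRank l g = m) (by omega), hH h1.le]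
          simp [f₂, h1]
      rw [Finset.sum_congr rfl key, Finset.sum_add_distrib, ← Finset.sum_filter,
        ← Finset.sum_filter, Finset.sum_const, Finset.sum_const, nsmul_eq_mul, nsmul_eq_mul,
        h.card_gapRank_eq_urnC hm, h.card_gapRank_gt_eq_urnD hm]
      have := hu m _ _ (urnC_pos hk l m) (h.urnD_pos m)
      linear_combination H * this
    · refine Finset.sum_eq_zero fun g hg => ?_
      have hg' : g ≤ l.length := by simpa [Nat.lt_succ_iff] using hg
      have := gapRank_le l g
      rw [Finset.prod_range_succ, ← mul_sub, h.urnC_insertString hk0 hg' m,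
        h.urnD_insertString hk0 hg' m, if_neg (by omega), if_neg (by omega), add_zero, add_zero,
        sub_self, mul_zero]

end Harmonic

/-! ### Laws on the unit cube are determined by their moments -/

theorem exists_polynomial_tendsto {f : ℝ → ℝ} (hf : Continuous f) :
    ∃ P : ℕ → Polynomial ℝ, (∀ n, ∀ x ∈ Set.Icc (0 : ℝ) 1, |(P n).eval x - f x| ≤ 1) ∧
      ∀ x ∈ Set.Icc (0 : ℝ) 1, Tendsto (fun n => (P n).eval x) atTop (𝓝 (f x)) := by
  have h : ∀ n : ℕ, ∃ P : Polynomial ℝ, ∀ x ∈ Set.Icc (0 : ℝ) 1,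
      |P.eval x - f x| < 1 / ((n : ℝ) + 1) := fun n =>
    exists_polynomial_near_of_continuousOn 0 1 f hf.continuousOn _ (by positivity)
  choose P hP using h
  refine ⟨P, fun n x hx => (hP n x hx).le.trans ?_, fun x hx => ?_⟩
  · rw [div_le_one (by positivity)]
    linarith [(Nat.cast_nonneg n : (0 : ℝ) ≤ n)]
  · rw [tendsto_iff_dist_tendsto_zero]
    exact squeeze_zero (fun _ => dist_nonneg) (fun n => (hP n x hx).le)
      tendsto_one_div_add_atTop_nhds_zero_nat

section Moments

variable {Ω : Type*} [MeasurableSpace Ω] {μ : Measure Ω} [IsProbabilityMeasure μ]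
  {X : ℕ → Ω → ℝ} {ν : ℕ → Measure ℝ} [∀ i, IsProbabilityMeasure (ν i)]

/-- A product formula for polynomials extends to continuous functions by the Weierstrass
approximation theorem. -/
theorem integral_prod_of_polynomial (hX : ∀ i, Measurable (X i))
    (hX01 : ∀ᵐ ω ∂μ, ∀ i, X i ω ∈ Set.Icc (0 : ℝ) 1)
    (hν : ∀ i, ∀ᵐ x ∂ν i, x ∈ Set.Icc (0 : ℝ) 1) {m : ℕ}
    (h : ∀ P : ℕ → Polynomial ℝ, ∫ ω, ∏ i ∈ Finset.range m, (P i).eval (X i ω) ∂μ =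
      ∏ i ∈ Finset.range m, ∫ x, (P i).eval x ∂ν i)
    (f : ℕ → ℝ → ℝ) (hf : ∀ i, Continuous (f i)) :
    ∫ ω, ∏ i ∈ Finset.range m, f i (X i ω) ∂μ = ∏ i ∈ Finset.range m, ∫ x, f i x ∂ν i := by
  choose P hP1 hP using fun i => exists_polynomial_tendsto (hf i)
  have hM : ∀ i, ∃ M : ℝ, ∀ x ∈ Set.Icc (0 : ℝ) 1, |f i x| ≤ M := fun i =>
    isCompact_Icc.exists_bound_of_continuousOn (hf i).continuousOn
  choose M hM using hM
  have hPM : ∀ i n, ∀ x ∈ Set.Icc (0 : ℝ) 1, |(P i n).eval x| ≤ M i + 1 := by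
    intro i n x hx
    have h1 := hP1 i n x hx
    have h2 := hM i x hx
    have := abs_add_le ((P i n).eval x - f i x) (f i x)
    rw [sub_add_cancel] at this
    linarith
  have hL : Tendsto (fun n => ∫ ω, ∏ i ∈ Finset.range m, (P i n).eval (X i ω) ∂μ) atTop
      (𝓝 (∫ ω, ∏ i ∈ Finset.range m, f i (X i ω) ∂μ)) := by
    refine tendsto_integral_of_dominated_convergence (fun _ => ∏ i ∈ Finset.range m, (M i + 1))
      (fun n => ?_) (integrable_const _) (fun n => ?_) ?_
    · exact (Finset.measurable_prod _ fun i _ =>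
        (P i n).continuous.measurable.comp (hX i)).aestronglyMeasurable
    · filter_upwards [hX01] with ω hω
      rw [Real.norm_eq_abs, Finset.abs_prod]
      exact Finset.prod_le_prod (fun _ _ => abs_nonneg _) fun i _ => hPM i n _ (hω i)
    · filter_upwards [hX01] with ω hω
      exact tendsto_finsetProd _ fun i _ => hP i _ (hω i)
  have hR : Tendsto (fun n => ∏ i ∈ Finset.range m, ∫ x, (P i n).eval x ∂ν i) atTop
      (𝓝 (∏ i ∈ Finset.range m, ∫ x, f i x ∂ν i)) := by
    refine tendsto_finsetProd _ fun i _ => ?_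
    refine tendsto_integral_of_dominated_convergence (fun _ => M i + 1)
      (fun n => (P i n).continuous.aestronglyMeasurable) (integrable_const _) (fun n => ?_) ?_
    · filter_upwards [hν i] with x hx
      exact hPM i n x hx
    · filter_upwards [hν i] with x hx
      exact hP i x hx
  refine tendsto_nhds_unique hL ?_
  simpa only [h fun i => P i _] using hR

theorem hasLaw_of_integral_prod_polynomial (hX : ∀ i, Measurable (X i))
    (hX01 : ∀ᵐ ω ∂μ, ∀ i, X i ω ∈ Set.Icc (0 : ℝ) 1)
    (hν : ∀ i, ∀ᵐ x ∂ν i, x ∈ Set.Icc (0 : ℝ) 1) {m : ℕ}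
    (h : ∀ P : ℕ → Polynomial ℝ, ∫ ω, ∏ i ∈ Finset.range m, (P i).eval (X i ω) ∂μ =
      ∏ i ∈ Finset.range m, ∫ x, (P i).eval x ∂ν i) {i : ℕ} (hi : i < m) :
    HasLaw (X i) (ν i) μ := by
  refine ⟨(hX i).aemeasurable, ?_⟩
  have := Measure.isProbabilityMeasure_map (μ := μ) (hX i).aemeasurable
  refine ext_of_forall_integral_eq_of_IsFiniteMeasure fun f => ?_
  rw [integral_map (hX i).aemeasurable f.continuous.aestronglyMeasurable]
  have := integral_prod_of_polynomial hX hX01 hν h (fun j x => if j = i then f x else 1)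
    (fun j => by by_cases e : j = i <;> simp only [e, if_true, if_false] <;> fun_prop)
  have e1 : ∀ ω, ∏ j ∈ Finset.range m, (if j = i then f (X j ω) else 1) = f (X i ω) := by
    intro ω
    rw [Finset.prod_ite_eq' _ _ fun j => f (X j ω), if_pos (Finset.mem_range.2 hi)]
  simp_rw [e1] at this
  rw [this, Finset.prod_eq_single i]
  · simp
  · intro j _ hj
    simp [hj]
  · exact fun h => absurd (Finset.mem_range.2 hi) h

/-- A finite measure on a finite product is determined by the integrals of products of bounded
continuous functions of the coordinates. -/
theorem ext_of_forall_integral_prod_eq {ι : Type*} [Fintype ι] {ρ₁ ρ₂ : Measure (ι → ℝ)}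
    [IsFiniteMeasure ρ₁] [IsFiniteMeasure ρ₂]
    (h : ∀ f : ι → BoundedContinuousFunction ℝ ℝ,
      ∫ x, ∏ i, f i (x i) ∂ρ₁ = ∫ x, ∏ i, f i (x i) ∂ρ₂) : ρ₁ = ρ₂ := by
  have hm : Measurable fun x : ι → ℝ => (x, ()) := measurable_id.prodMk measurable_const
  have key : ρ₁.map (fun x => (x, ())) = ρ₂.map fun x => (x, ()) := by
    refine Measure.ext_of_integral_prod_mul_boundedContinuousFunction fun f g => ?_
    have hc : Continuous fun p : (ι → ℝ) × Unit => (∏ i, f i (p.1 i)) * g p.2 := by fun_prop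
    rw [integral_map hm.aemeasurable (by exact hc.aestronglyMeasurable),
      integral_map hm.aemeasurable (by exact hc.aestronglyMeasurable)]
    dsimp only
    rw [integral_mul_const, integral_mul_const, h f]
  have := congrArg (fun ρ => Measure.map Prod.fst ρ) key
  simp only [Measure.map_map measurable_fst hm] at this
  change ρ₁.map id = ρ₂.map id at this
  rwa [Measure.map_id, Measure.map_id] at this

theorem iIndepFun_of_integral_prod_polynomial (hX : ∀ i, Measurable (X i))
    (hX01 : ∀ᵐ ω ∂μ, ∀ i, X i ω ∈ Set.Icc (0 : ℝ) 1)
    (hν : ∀ i, ∀ᵐ x ∂ν i, x ∈ Set.Icc (0 : ℝ) 1)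
    (h : ∀ (m : ℕ) (P : ℕ → Polynomial ℝ), ∫ ω, ∏ i ∈ Finset.range m, (P i).eval (X i ω) ∂μ =
      ∏ i ∈ Finset.range m, ∫ x, (P i).eval x ∂ν i) :
    iIndepFun X μ := by
  have hlaw : ∀ i, HasLaw (X i) (ν i) μ := fun i =>
    hasLaw_of_integral_prod_polynomial hX hX01 hν (h (i + 1)) (Nat.lt_succ_self i)
  rw [iIndepFun_iff_finset]
  intro s
  rw [iIndepFun_iff_map_fun_eq_pi_map (f := s.restrict X) fun i => (hX i).aemeasurable]
  have hmeas : Measurable fun ω (i : s) => X i ω := measurable_pi_lambda _ fun i => hX i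
  have e : ∀ i : s, μ.map (s.restrict X i) = ν i := fun i => (hlaw i).map_eq
  simp_rw [e]
  have := Measure.isProbabilityMeasure_map (μ := μ) hmeas.aemeasurable
  change μ.map (fun ω (i : s) => X i ω) = _
  refine ext_of_forall_integral_prod_eq fun f => ?_
  rw [integral_map hmeas.aemeasurable
    (by
      refine Continuous.aestronglyMeasurable ?_
      fun_prop), integral_fintype_prod_eq_prod (fun (i : s) x => f i x)]
  obtain ⟨m, hm⟩ := s.exists_nat_subset_range
  have hc := integral_prod_of_polynomial hX hX01 hν (h m)
    (fun j x => if hj : j ∈ s then f ⟨j, hj⟩ x else 1)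
    (fun j => by
      by_cases e : j ∈ s <;> simp only [e, dif_pos, dif_neg, not_false_eq_true] <;> fun_prop)
  -- the factors outside `s` are trivial
  have red : ∀ F : ℕ → ℝ, (∀ j ∉ s, F j = 1) →
      ∏ j ∈ Finset.range m, F j = ∏ j : s, F j := by
    intro F hF
    rw [Finset.prod_coe_sort s F]
    exact (Finset.prod_subset hm fun j _ hj => hF j hj).symm
  rw [red _ fun j hj => by simp [hj]] at hc
  have e1 : ∀ ω, ∏ j ∈ Finset.range m, (if hj : j ∈ s then f ⟨j, hj⟩ (X j ω) else 1) =
      ∏ j : s, f j (X j ω) := by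
    intro ω
    rw [red _ fun j hj => by simp [hj]]
    exact Finset.prod_congr rfl fun j _ => by simp
  simp_rw [e1] at hc
  rw [hc]
  exact Finset.prod_congr rfl fun j _ => by simp

end Moments

/-! ### The growing word as a random process -/

section Growth

variable {Ω : Type*} {k : ℕ}

/-- The word that grows out of the empty word by adding the string `(n+1)^k` in the gap `G n`. -/
def growWord (k : ℕ) (G : (n : ℕ) → Ω → Fin (k * n + 1)) : ℕ → Ω → List ℕ
  | 0, _ => []
  | n + 1, ω => insertString k (n + 1) (G n ω) (growWord k G n ω)

theorem isGrown_growWord (hk : 0 < k) (G : (n : ℕ) → Ω → Fin (k * n + 1)) (n : ℕ) (ω : Ω) :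
    IsGrown k n (growWord k G n ω) := by
  induction n with
  | zero => exact isGrown_nil k
  | succ n ih =>
    refine ih.insertString hk ?_
    rw [ih.length_eq]
    exact Nat.lt_succ_iff.1 (G n ω).2

variable {mΩ : MeasurableSpace Ω} {G : (n : ℕ) → Ω → Fin (k * n + 1)}

/-- The filtration of the choices of gaps: at time `n`, the gaps `G j` with `j < n` are known. -/
def gapFiltration (hG : ∀ n, Measurable (G n)) : Filtration ℕ mΩ where
  seq n := ⨆ j ∈ Set.Iio n, MeasurableSpace.comap (G j) inferInstance
  mono' _ _ h := biSup_mono fun _ hj => lt_of_lt_of_le hj h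
  le' _ := iSup₂_le fun j _ => (hG j).comap_le

theorem measurableSet_growWord_eq (hG : ∀ n, Measurable (G n)) (n : ℕ) (w : List ℕ) :
    MeasurableSet[gapFiltration hG n] {ω | growWord k G n ω = w} := by
  induction n generalizing w with
  | zero => exact @MeasurableSet.const Ω (gapFiltration hG 0) ([] = w)
  | succ n ih =>
    have : {ω | growWord k G (n + 1) ω = w} = ⋃ g : Fin (k * n + 1),
        ⋃ v ∈ {v : List ℕ | insertString k (n + 1) g v = w},
          {ω | G n ω = g} ∩ {ω | growWord k G n ω = v} := by
      ext ω
      simp [growWord]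
    rw [this]
    refine MeasurableSet.iUnion fun g => MeasurableSet.biUnion (Set.to_countable _) fun v _ => ?_
    refine MeasurableSet.inter ?_ ((gapFiltration hG).mono (Nat.le_succ n) _ (ih v))
    have h1 : MeasurableSpace.comap (G n) inferInstance ≤ gapFiltration hG (n + 1) :=
      le_biSup (fun j => MeasurableSpace.comap (G j) inferInstance) (Nat.lt_succ_self n)
    exact h1 _ ⟨{g}, MeasurableSet.singleton g, rfl⟩

theorem measurable_comp_growWord (hG : ∀ n, Measurable (G n)) (n : ℕ) (F : List ℕ → ℝ) :
    Measurable[gapFiltration hG n] fun ω => F (growWord k G n ω) := by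
  intro s _
  have : (fun ω => F (growWord k G n ω)) ⁻¹' s =
      ⋃ w ∈ F ⁻¹' s, {ω | growWord k G n ω = w} := by
    ext ω
    simp
  rw [this]
  exact MeasurableSet.biUnion (Set.to_countable _) fun w _ => measurableSet_growWord_eq hG n w

variable {μ : Measure Ω} [IsProbabilityMeasure μ]

/-- The gap `G n` is independent of the gaps chosen before it. -/
theorem condExp_indicator_gap (hG : ∀ n, Measurable (G n)) (hind : iIndepFun G μ)
    (n : ℕ) (g : Fin (k * n + 1)) :
    μ[({ω | G n ω = g}.indicator fun _ => (1 : ℝ)) | gapFiltration hG n] =ᵐ[μ]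
      fun _ => μ.real {ω | G n ω = g} := by
  have hi : Indep (MeasurableSpace.comap (G n) inferInstance) (gapFiltration hG n) μ := by
    have := indep_iSup_of_disjoint (fun i => (hG i).comap_le) hind.iIndep
      (S := {n}) (T := Set.Iio n) (by simp)
    simpa [gapFiltration] using this
  have hms : MeasurableSet[MeasurableSpace.comap (G n) inferInstance] {ω | G n ω = g} :=
    ⟨{g}, MeasurableSet.singleton g, rfl⟩
  refine (condExp_indep_eq (hG n).comap_le ((gapFiltration hG).le n)
    (stronglyMeasurable_const.indicator hms) hi).trans ?_
  rw [integral_indicator_const _ ((hG n).comap_le _ hms), smul_eq_mul, mul_one]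

/-- A bounded function of words that equals its mean over the insertions of the next string turns
the growing word into a martingale. -/
theorem martingale_comp_growWord (hk : 0 < k) (hG : ∀ n, Measurable (G n)) (hind : iIndepFun G μ)
    (hunif : ∀ n, ∀ g : Fin (k * n + 1), μ.real {ω | G n ω = g} = 1 / ((k : ℝ) * n + 1))
    {F : List ℕ → ℝ} {B : ℝ} (hB : ∀ n l, IsGrown k n l → |F l| ≤ B)
    (hF : ∀ n l, IsGrown k n l → ∑ g ∈ Finset.range (l.length + 1),
      F (insertString k (n + 1) g l) = (l.length + 1) * F l) :
    Martingale (fun n ω => F (growWord k G n ω)) (gapFiltration hG) μ := by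
  have hint : ∀ n, Integrable (fun ω => F (growWord k G n ω)) μ := fun n =>
    Integrable.of_bound ((measurable_comp_growWord hG n F).mono
      ((gapFiltration hG).le n) le_rfl).aestronglyMeasurable B
      (Eventually.of_forall fun ω => hB n _ (isGrown_growWord hk G n ω))
  refine martingale_nat (fun n => (measurable_comp_growWord hG n F).stronglyMeasurable) hint
    fun n => ?_
  let f : Fin (k * n + 1) → Ω → ℝ := fun g ω => F (insertString k (n + 1) g (growWord k G n ω))
  let χ : Fin (k * n + 1) → Ω → ℝ := fun g => {ω | G n ω = g}.indicator fun _ => 1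
  have hsplit : (fun ω => F (growWord k G (n + 1) ω)) = ∑ g, f g * χ g := by
    funext ω
    simp [f, χ, Finset.sum_apply, Set.indicator_apply, growWord]
  have hfm : ∀ g, Measurable[gapFiltration hG n] (f g) := fun g =>
    measurable_comp_growWord hG n fun l => F (insertString k (n + 1) g l)
  have hχ : ∀ g, Integrable (χ g) μ := fun g =>
    (integrable_const 1).indicator (hG n (MeasurableSet.singleton g))
  have hfB : ∀ g ω, ‖f g ω‖ ≤ B := by
    intro g ω
    have h := isGrown_growWord hk G n ω
    refine hB (n + 1) _ (h.insertString hk ?_)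
    rw [h.length_eq]
    exact Nat.lt_succ_iff.1 g.2
  have hfχ : ∀ g, Integrable (f g * χ g) μ := fun g =>
    (hχ g).bdd_mul ((hfm g).mono ((gapFiltration hG).le n) le_rfl).aestronglyMeasurable
      (Eventually.of_forall (hfB g))
  have h1 : μ[∑ g, f g * χ g | gapFiltration hG n] =ᵐ[μ]
      ∑ g, μ[f g * χ g | gapFiltration hG n] :=
    condExp_finsetSum (fun g _ => hfχ g) _
  have h2 : ∀ g, μ[f g * χ g | gapFiltration hG n] =ᵐ[μ] fun ω =>
      f g ω * (1 / ((k : ℝ) * n + 1)) := by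
    intro g
    refine (condExp_mul_of_stronglyMeasurable_left (hfm g).stronglyMeasurable (hfχ g)
      (hχ g)).trans ?_
    filter_upwards [condExp_indicator_gap hG hind n g] with ω hω
    rw [Pi.mul_apply, hω, hunif]
  rw [hsplit]
  filter_upwards [h1, ae_all_iff.2 h2] with ω hω1 hω2
  have h := isGrown_growWord hk G n ω
  have hlen : ((growWord k G n ω).length : ℝ) = k * n := by
    rw [h.length_eq, Nat.cast_mul]
  have hsum := hF n _ h
  rw [h.length_eq,
    Finset.sum_range fun g => F (insertString k (n + 1) g (growWord k G n ω))] at hsum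
  rw [hω1, Finset.sum_apply, Finset.sum_congr rfl fun g _ => hω2 g, ← Finset.sum_mul]
  change _ = (∑ g : Fin (k * n + 1), F (insertString k (n + 1) g (growWord k G n ω))) * _
  rw [hsum]
  push_cast
  field_simp

/-- A product of functions of the urns that are harmonic for their urns is a martingale. -/
theorem martingale_prod_urn (hk : 2 ≤ k) (hG : ∀ n, Measurable (G n)) (hind : iIndepFun G μ)
    (hunif : ∀ n, ∀ g : Fin (k * n + 1), μ.real {ω | G n ω = g} = 1 / ((k : ℝ) * n + 1))
    (u : ℕ → ℝ → ℝ → ℝ)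
    (hu : ∀ i C D, 0 < C → 0 < D → C * u i (C + k) D + D * u i C (D + k) = (C + D) * u i C D)
    {B : ℕ → ℝ} (hB : ∀ i C D, 0 < C → 0 < D → |u i C D| ≤ B i) (m : ℕ) :
    Martingale (fun n ω => ∏ i ∈ Finset.range m,
      u i (urnC k (growWord k G n ω) i) (urnD (growWord k G n ω) i)) (gapFiltration hG) μ :=
  martingale_comp_growWord (by omega) hG hind hunif
    (F := fun l => ∏ i ∈ Finset.range m, u i (urnC k l i) (urnD l i))
    (B := ∏ i ∈ Finset.range m, B i)
    (fun n l h => by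
      rw [Finset.abs_prod]
      exact Finset.prod_le_prod (fun _ _ => abs_nonneg _)
        fun i _ => hB i _ _ (urnC_pos hk l i) (h.urnD_pos i))
    fun n l h => h.sum_prod_urn hk u hu m

/-- The fraction of the weight of block `i` in its urn. -/
noncomputable def urnFraction (G : (n : ℕ) → Ω → Fin (k * n + 1)) (i n : ℕ) (ω : Ω) : ℝ :=
  urnC k (growWord k G n ω) i / (urnC k (growWord k G n ω) i + urnD (growWord k G n ω) i)

theorem urnFraction_mem (hk : 2 ≤ k) (i n : ℕ) (ω : Ω) :
    urnFraction G i n ω ∈ Set.Icc (0 : ℝ) 1 := by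
  have hC := urnC_pos hk (growWord k G n ω) i
  have hD := (isGrown_growWord (by omega) G n ω).urnD_pos i
  unfold urnFraction
  constructor
  · positivity
  · rw [div_le_one (by positivity)]
    linarith

theorem martingale_urnFraction (hk : 2 ≤ k) (hG : ∀ n, Measurable (G n)) (hind : iIndepFun G μ)
    (hunif : ∀ n, ∀ g : Fin (k * n + 1), μ.real {ω | G n ω = g} = 1 / ((k : ℝ) * n + 1)) (i : ℕ) :
    Martingale (urnFraction G i) (gapFiltration hG) μ := by
  have := martingale_prod_urn (μ := μ) hk hG hind hunif
    (fun j C D => if j = i then C / (C + D) else 1)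
    (fun j C D hC hD => by
      have : (0 : ℝ) < k := by positivity
      split_ifs <;> field_simp; ring) (B := fun _ => 1)
    (fun j C D hC hD => by
      split_ifs
      · rw [abs_of_pos (by positivity), div_le_one (by positivity)]
        linarith
      · simp) (i + 1)
  convert! this using 3 with n ω
  rw [Finset.prod_ite_eq' _ _ fun j => urnC k (growWord k G n ω) j /
    (urnC k (growWord k G n ω) j + urnD (growWord k G n ω) j), if_pos (by simp)]
  rfl

/-- The limit of the fraction of the weight of block `i` in its urn, defined everywhere as an upper
limit. -/
noncomputable def limitFraction (G : (n : ℕ) → Ω → Fin (k * n + 1)) (i : ℕ) (ω : Ω) : ℝ :=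
  limsup (fun n => urnFraction G i n ω) atTop

theorem measurable_limitFraction (hG : ∀ n, Measurable (G n)) (i : ℕ) :
    Measurable (limitFraction G i) :=
  Measurable.limsup fun n => (measurable_comp_growWord hG n fun l =>
    urnC k l i / (urnC k l i + urnD l i)).mono ((gapFiltration hG).le n) le_rfl

theorem ae_tendsto_urnFraction (hk : 2 ≤ k) (hG : ∀ n, Measurable (G n)) (hind : iIndepFun G μ)
    (hunif : ∀ n, ∀ g : Fin (k * n + 1), μ.real {ω | G n ω = g} = 1 / ((k : ℝ) * n + 1)) :
    ∀ᵐ ω ∂μ, ∀ i, Tendsto (fun n => urnFraction G i n ω) atTop (𝓝 (limitFraction G i ω)) := by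
  refine ae_all_iff.2 fun i => ?_
  have h := (martingale_urnFraction hk hG hind hunif i).submartingale.exists_ae_tendsto_of_bdd
    (R := 1) fun n => (eLpNorm_le_of_ae_bound (C := 1) (Eventually.of_forall fun ω => by
      have := urnFraction_mem (G := G) hk i n ω
      rw [Real.norm_of_nonneg this.1]
      exact this.2)).trans (by simp)
  filter_upwards [h] with ω ⟨c, hc⟩
  rwa [limitFraction, hc.limsup_eq]

theorem ae_limitFraction_mem (hk : 2 ≤ k) (hG : ∀ n, Measurable (G n)) (hind : iIndepFun G μ)
    (hunif : ∀ n, ∀ g : Fin (k * n + 1), μ.real {ω | G n ω = g} = 1 / ((k : ℝ) * n + 1)) :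
    ∀ᵐ ω ∂μ, ∀ i, limitFraction G i ω ∈ Set.Icc (0 : ℝ) 1 := by
  filter_upwards [ae_tendsto_urnFraction hk hG hind hunif] with ω hω i
  exact isClosed_Icc.mem_of_tendsto (hω i) (Eventually.of_forall fun n => urnFraction_mem hk i n ω)

/-- The weight in the urn of block `i` tends to infinity. -/
def UrnGrows (G : (n : ℕ) → Ω → Fin (k * n + 1)) (i : ℕ) (ω : Ω) : Prop :=
  Tendsto (fun n => urnC k (growWord k G n ω) i + urnD (growWord k G n ω) i) atTop atTop

/-- The joint moments of the limit fractions are those of independent beta variables, provided the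
urns grow: a product of the martingales `urnMoment` has the same expectation at time `0`, where it
is constant, and in the limit. -/
theorem integral_prod_limitFraction (hk : 2 ≤ k) (hG : ∀ n, Measurable (G n))
    (hind : iIndepFun G μ)
    (hunif : ∀ n, ∀ g : Fin (k * n + 1), μ.real {ω | G n ω = g} = 1 / ((k : ℝ) * n + 1))
    {m : ℕ} (hm : ∀ i < m, ∀ᵐ ω ∂μ, UrnGrows G i ω) (P : ℕ → Polynomial ℝ) :
    ∫ ω, ∏ i ∈ Finset.range m, (P i).eval (limitFraction G i ω) ∂μ =
      ∏ i ∈ Finset.range m,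
        ∫ x, (P i).eval x ∂betaMeasure (((k : ℝ) - 1) / k) (((i : ℝ) + 2) / k) := by
  have hk0 : (0 : ℝ) < k := by positivity
  set M : ℕ → Ω → ℝ := fun n ω => ∏ i ∈ Finset.range m,
    urnMoment k (P i) (urnC k (growWord k G n ω) i) (urnD (growWord k G n ω) i) with hMdef
  have hmart : Martingale M (gapFiltration hG) μ :=
    martingale_prod_urn (μ := μ) hk hG hind hunif (fun i => urnMoment k (P i))
      (fun i C D hC hD => urnMoment_step hk0 hC hD (P i))
      (fun i C D hC hD => abs_urnMoment_le hk0 hC hD (P i)) m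
  have hconst : ∀ n, ∫ ω, M n ω ∂μ = ∫ ω, M 0 ω ∂μ := by
    intro n
    rw [← integral_condExp ((gapFiltration hG).le 0)]
    exact integral_congr_ae (hmart.condExp_ae_eq (Nat.zero_le n))
  have hlim : Tendsto (fun n => ∫ ω, M n ω ∂μ) atTop
      (𝓝 (∫ ω, ∏ i ∈ Finset.range m, (P i).eval (limitFraction G i ω) ∂μ)) := by
    refine tendsto_integral_of_dominated_convergence (fun _ => ∏ i ∈ Finset.range m,
      ∑ j ∈ Finset.range ((P i).natDegree + 1), |(P i).coeff j|)
      (fun n => (hmart.integrable n).aestronglyMeasurable) (integrable_const _)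
      (fun n => Eventually.of_forall fun ω => ?_) ?_
    · rw [Real.norm_eq_abs, Finset.abs_prod]
      exact Finset.prod_le_prod (fun _ _ => abs_nonneg _) fun i _ => abs_urnMoment_le hk0
        (urnC_pos hk _ i) ((isGrown_growWord (by omega) G n ω).urnD_pos i) (P i)
    · have hm' : ∀ᵐ ω ∂μ, ∀ i, i < m → UrnGrows G i ω :=
        ae_all_iff.2 fun i => by
          by_cases hi : i < m
          · filter_upwards [hm i hi] with ω hω _ using hω
          · exact Eventually.of_forall fun ω h => absurd h hi
      filter_upwards [hm', ae_tendsto_urnFraction hk hG hind hunif] with ω h1 h2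
      exact tendsto_finsetProd _ fun i hi =>
        tendsto_urnMoment (P i) (h1 i (Finset.mem_range.1 hi)) (h2 i)
  have h0 : ∫ ω, M 0 ω ∂μ = ∏ i ∈ Finset.range m,
      ∫ x, (P i).eval x ∂betaMeasure (((k : ℝ) - 1) / k) (((i : ℝ) + 2) / k) := by
    have : ∀ ω, M 0 ω = ∏ i ∈ Finset.range m,
        ∫ x, (P i).eval x ∂betaMeasure (((k : ℝ) - 1) / k) (((i : ℝ) + 2) / k) := by
      intro ω
      refine Finset.prod_congr rfl fun i _ => ?_
      have hz : ∀ j, labelBlockSize [] j = 0 := fun j => labelBlockSize_eq_zero (by simp [blocks])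
      have e1 : urnC k (growWord k G 0 ω) i = (k : ℝ) - 1 := by
        simp [urnC, growWord, hz]
      have e2 : urnD (growWord k G 0 ω) i = (i : ℝ) + 2 := by
        simp [urnD, growWord, hz]
      have hk1 : (0 : ℝ) < k - 1 := by
        have : (2 : ℝ) ≤ k := by exact_mod_cast hk
        linarith
      rw [e1, e2, urnMoment_eq_integral hk0 hk1 (by positivity)]
    simp_rw [this]
    simp
  rw [← h0]
  exact tendsto_nhds_unique hlim (by simp_rw [hconst]; exact tendsto_const_nhds)

end Growth

/-! ### Asymptotic block frequencies -/

section Frequencies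

variable {Ω : Type*} {k : ℕ} {G : (n : ℕ) → Ω → Fin (k * n + 1)}

/-- The number of gaps of the word at time `n` that are not inside one of the first `i` blocks,
ordered by label, as long as these exist. -/
noncomputable def remainingGaps (G : (n : ℕ) → Ω → Fin (k * n + 1)) (i n : ℕ) (ω : Ω) : ℝ :=
  i + 1 + (growWord k G n ω).length -
    ∑ j ∈ Finset.range i, (labelBlockSize (growWord k G n ω) j : ℝ)

theorem urnC_add_urnD (i n : ℕ) (ω : Ω) :
    urnC k (growWord k G n ω) i + urnD (growWord k G n ω) i =
      remainingGaps G i n ω + (((max (labelBlockSize (growWord k G n ω) i) k : ℕ) : ℝ) -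
        labelBlockSize (growWord k G n ω) i) := by
  unfold urnC urnD remainingGaps
  rw [Finset.sum_range_succ]
  ring

theorem tendsto_mul_natCast_atTop (hk : 0 < k) :
    Tendsto (fun n : ℕ => (k : ℝ) * n) atTop atTop :=
  tendsto_natCast_atTop_atTop.const_mul_atTop (by exact_mod_cast hk)

theorem tendsto_max_sub_div (hk : 0 < k) (i : ℕ) (ω : Ω) :
    Tendsto (fun n : ℕ => (((max (labelBlockSize (growWord k G n ω) i) k : ℕ) : ℝ) -
        labelBlockSize (growWord k G n ω) i) / ((k : ℝ) * n)) atTop (𝓝 0) := by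
  have h1 : Tendsto (fun n : ℕ => (k : ℝ) / ((k : ℝ) * n)) atTop (𝓝 0) :=
    (tendsto_mul_natCast_atTop hk).const_div_atTop _
  have hb : ∀ N : ℕ, (N : ℝ) ≤ (max N k : ℕ) ∧ ((max N k : ℕ) : ℝ) ≤ N + k := fun N =>
    ⟨by exact_mod_cast le_max_left N k,
      by exact_mod_cast (by omega : max N k ≤ N + k)⟩
  refine squeeze_zero (fun n => ?_) (fun n => ?_) h1
  · exact div_nonneg (by linarith [(hb (labelBlockSize (growWord k G n ω) i)).1]) (by positivity)
  · exact div_le_div_of_nonneg_right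
      (by linarith [(hb (labelBlockSize (growWord k G n ω) i)).2]) (by positivity)

variable {β : ℕ → ℝ} {ω : Ω}

theorem urnGrows_of_tendsto (hk : 0 < k) {i : ℕ} {π : ℝ} (hπ : 0 < π)
    (h : Tendsto (fun n : ℕ => remainingGaps G i n ω / ((k : ℝ) * n)) atTop (𝓝 π)) :
    UrnGrows G i ω := by
  have h1 : Tendsto (fun n : ℕ => remainingGaps G i n ω) atTop atTop := by
    refine (h.pos_mul_atTop hπ (tendsto_mul_natCast_atTop hk)).congr' ?_
    filter_upwards [(tendsto_mul_natCast_atTop hk).eventually_gt_atTop 0] with n hn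
    exact div_mul_cancel₀ _ hn.ne'
  refine tendsto_atTop_mono (fun n => ?_) h1
  rw [urnC_add_urnD]
  have : (labelBlockSize (growWord k G n ω) i : ℝ) ≤
      (max (labelBlockSize (growWord k G n ω) i) k : ℕ) := by exact_mod_cast le_max_left _ _
  linarith

theorem tendsto_labelBlockSize_of_tendsto (hk : 0 < k) {i : ℕ} {π b : ℝ} (hπ : 0 < π)
    (hb : Tendsto (fun n => urnFraction G i n ω) atTop (𝓝 b))
    (h : Tendsto (fun n : ℕ => remainingGaps G i n ω / ((k : ℝ) * n)) atTop (𝓝 π)) :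
    Tendsto (fun n : ℕ => (labelBlockSize (growWord k G n ω) i : ℝ) / ((k : ℝ) * n)) atTop
      (𝓝 (b * π)) := by
  have h0 := tendsto_max_sub_div (G := G) hk i ω
  have h1 : Tendsto (fun n : ℕ => (1 : ℝ) / ((k : ℝ) * n)) atTop (𝓝 0) :=
    (tendsto_mul_natCast_atTop hk).const_div_atTop _
  -- the size is the weight `urnC` up to an error of at most `k + 1`, which vanishes in the limit
  have h2 := ((hb.mul (h.add h0)).add h1).sub h0
  rw [add_zero, add_zero, sub_zero] at h2
  refine h2.congr' ?_
  filter_upwards [(urnGrows_of_tendsto hk hπ h).eventually_gt_atTop 0] with n hn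
  rw [← add_div, ← urnC_add_urnD, urnFraction, mul_div_assoc', div_mul_cancel₀ _ hn.ne', ← add_div,
    ← sub_div]
  congr 1
  unfold urnC
  ring

/-- As long as the limits of the urn fractions are less than `1`, the proportion of the gaps that
are left after `i` blocks is given by the stick-breaking rule. -/
theorem tendsto_remainingGaps (hk : 0 < k)
    (hb : ∀ i, Tendsto (fun n => urnFraction G i n ω) atTop (𝓝 (β i))) (i : ℕ)
    (h1 : ∀ j < i, β j < 1) :
    Tendsto (fun n : ℕ => remainingGaps G i n ω / ((k : ℝ) * n)) atTop
      (𝓝 (∏ j ∈ Finset.range i, (1 - β j))) := by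
  have hinv : Tendsto (fun n : ℕ => (1 : ℝ) / ((k : ℝ) * n)) atTop (𝓝 0) :=
    (tendsto_mul_natCast_atTop hk).const_div_atTop _
  induction i with
  | zero =>
    have := hinv.add_const 1
    rw [zero_add] at this
    rw [Finset.prod_range_zero]
    refine this.congr' ?_
    filter_upwards [(tendsto_mul_natCast_atTop hk).eventually_gt_atTop 0] with n hn
    rw [div_add_one hn.ne']
    simp [remainingGaps, (isGrown_growWord hk G n ω).length_eq]
  | succ i ih =>
    have ih' := ih fun j hj => h1 j (hj.trans (Nat.lt_succ_self i))
    have hpos : 0 < ∏ j ∈ Finset.range i, (1 - β j) := Finset.prod_pos fun j hj =>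
      sub_pos.2 (h1 j ((Finset.mem_range.1 hj).trans (Nat.lt_succ_self i)))
    have h2 := (ih'.add hinv).sub (tendsto_labelBlockSize_of_tendsto hk hpos (hb i) ih')
    rw [Finset.prod_range_succ]
    refine (h2.congr fun n => ?_).trans_eq ?_
    · rw [← add_div, ← sub_div]
      congr 1
      unfold remainingGaps
      rw [Finset.sum_range_succ]
      push_cast
      ring
    · congr 1
      ring

end Frequencies

section Limit

variable {Ω : Type*} {k : ℕ} {mΩ : MeasurableSpace Ω} {G : (n : ℕ) → Ω → Fin (k * n + 1)}
  {μ : Measure Ω}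

/-- The law of the limit fraction of block `i`, counted from `0`. -/
noncomputable def fractionLaw (k i : ℕ) : Measure ℝ :=
  betaMeasure (((k : ℝ) - 1) / k) (((i : ℝ) + 2) / k)

theorem isProbabilityMeasure_fractionLaw (hk : 2 ≤ k) (i : ℕ) :
    IsProbabilityMeasure (fractionLaw k i) := by
  have h2 : (2 : ℝ) ≤ k := by exact_mod_cast hk
  exact isProbabilityMeasureBeta (div_pos (by linarith) (by linarith)) (by positivity)

theorem ae_fractionLaw_mem (k i : ℕ) : ∀ᵐ x ∂fractionLaw k i, x ∈ Set.Icc (0 : ℝ) 1 := by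
  filter_upwards [ae_betaMeasure_mem_Ioo (((k : ℝ) - 1) / k) (((i : ℝ) + 2) / k)] with x hx
  exact ⟨hx.1.le, hx.2.le⟩

theorem ae_mem_Ioo_of_hasLaw {X : Ω → ℝ} {i : ℕ} (h : HasLaw X (fractionLaw k i) μ) :
    ∀ᵐ ω ∂μ, X ω ∈ Set.Ioo (0 : ℝ) 1 := by
  refine ae_of_ae_map (p := fun x => x ∈ Set.Ioo (0 : ℝ) 1) h.aemeasurable ?_
  rw [h.map_eq]
  exact ae_betaMeasure_mem_Ioo _ _

variable [IsProbabilityMeasure μ]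
variable (hk : 2 ≤ k) (hG : ∀ n, Measurable (G n)) (hind : iIndepFun G μ)
  (hunif : ∀ n, ∀ g : Fin (k * n + 1), μ.real {ω | G n ω = g} = 1 / ((k : ℝ) * n + 1))

include hk hG hind hunif

/-- If the urns before `i` grow, then their limit fractions have beta laws, hence are less than
`1`, which makes the urn of block `i` grow as well. -/
theorem ae_urnGrows (i : ℕ) : ∀ᵐ ω ∂μ, UrnGrows G i ω := by
  have := isProbabilityMeasure_fractionLaw hk
  induction i using Nat.strong_induction_on with
  | _ i ih =>
    have hlaw : ∀ j, j < i → HasLaw (limitFraction G j) (fractionLaw k j) μ := fun j hj =>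
      hasLaw_of_integral_prod_polynomial (measurable_limitFraction hG)
        (ae_limitFraction_mem hk hG hind hunif) (ae_fractionLaw_mem k)
        (integral_prod_limitFraction hk hG hind hunif ih) hj
    have hlt : ∀ᵐ ω ∂μ, ∀ j, j < i → limitFraction G j ω < 1 := ae_all_iff.2 fun j => by
      by_cases hj : j < i
      · filter_upwards [ae_mem_Ioo_of_hasLaw (hlaw j hj)] with ω hω _ using hω.2
      · exact Eventually.of_forall fun ω h => absurd h hj
    filter_upwards [hlt, ae_tendsto_urnFraction hk hG hind hunif] with ω h1 h2
    exact urnGrows_of_tendsto (by omega) (Finset.prod_pos fun j hj =>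
      sub_pos.2 (h1 j (Finset.mem_range.1 hj))) (tendsto_remainingGaps (by omega) h2 i h1)

theorem hasLaw_limitFraction (i : ℕ) : HasLaw (limitFraction G i) (fractionLaw k i) μ := by
  have := isProbabilityMeasure_fractionLaw hk
  exact hasLaw_of_integral_prod_polynomial (measurable_limitFraction hG)
    (ae_limitFraction_mem hk hG hind hunif) (ae_fractionLaw_mem k)
    (integral_prod_limitFraction hk hG hind hunif fun j _ => ae_urnGrows hk hG hind hunif j)
    (Nat.lt_succ_self i)

theorem iIndepFun_limitFraction : iIndepFun (limitFraction G) μ := by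
  have := isProbabilityMeasure_fractionLaw hk
  exact iIndepFun_of_integral_prod_polynomial (measurable_limitFraction hG)
    (ae_limitFraction_mem hk hG hind hunif) (ae_fractionLaw_mem k) fun m =>
    integral_prod_limitFraction hk hG hind hunif fun j _ => ae_urnGrows hk hG hind hunif j

theorem ae_limitFraction_mem_Ioo : ∀ᵐ ω ∂μ, ∀ i, limitFraction G i ω ∈ Set.Ioo (0 : ℝ) 1 :=
  ae_all_iff.2 fun i => ae_mem_Ioo_of_hasLaw (hasLaw_limitFraction hk hG hind hunif i)

theorem ae_tendsto_labelBlockSize : ∀ᵐ ω ∂μ, ∀ i, Tendsto (fun n : ℕ =>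
    (labelBlockSize (growWord k G n ω) i : ℝ) / ((k : ℝ) * n)) atTop
      (𝓝 (stickBreaking (fun m => limitFraction G m ω) i)) := by
  filter_upwards [ae_limitFraction_mem_Ioo hk hG hind hunif,
    ae_tendsto_urnFraction hk hG hind hunif] with ω h1 h2 i
  exact tendsto_labelBlockSize_of_tendsto (by omega)
    (Finset.prod_pos fun j _ => sub_pos.2 (h1 j).2) (h2 i)
    (tendsto_remainingGaps (by omega) h2 i fun j _ => (h1 j).2)

/-- The expectation is the product of the `(i + 2) / (i + k + 1)`, each of which is at most
`(i + 2) / (i + 3)` as `k ≥ 2`. -/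
theorem integral_prod_one_sub_limitFraction_le (m : ℕ) :
    ∫ ω, ∏ i ∈ Finset.range m, (1 - limitFraction G i ω) ∂μ ≤ 2 / ((m : ℝ) + 2) := by
  have hk2 : (2 : ℝ) ≤ k := by exact_mod_cast hk
  have h := integral_prod_limitFraction hk hG hind hunif (m := m)
    (fun j _ => ae_urnGrows hk hG hind hunif j) fun _ => 1 - Polynomial.X
  simp only [Polynomial.eval_sub, Polynomial.eval_one, Polynomial.eval_X] at h
  rw [h]
  have h1 : ∀ i : ℕ, ∫ x, (1 - x) ∂betaMeasure (((k : ℝ) - 1) / k) (((i : ℝ) + 2) / k) =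
      ((i : ℝ) + 2) / (i + k + 1) := by
    intro i
    have ha : 0 < ((k : ℝ) - 1) / k := div_pos (by linarith) (by linarith)
    have hb : 0 < ((i : ℝ) + 2) / k := by positivity
    have := isProbabilityMeasureBeta ha hb
    have hm := integral_pow_betaMeasure ha hb 1
    simp only [pow_one, Finset.prod_range_one, Nat.cast_zero, add_zero] at hm
    rw [integral_sub (integrable_const _)
      (integrable_betaMeasure_of_continuous ha hb continuous_id'), hm]
    simp only [integral_const, probReal_univ, smul_eq_mul, mul_one]
    have : (k : ℝ) ≠ 0 := by positivity
    have : (i : ℝ) + k + 1 ≠ 0 := by positivity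
    rw [← add_div, div_div_div_cancel_right₀ ‹(k : ℝ) ≠ 0›,
      show (k : ℝ) - 1 + (i + 2) = i + k + 1 by ring, one_sub_div this]
    congr 1
    ring
  simp_rw [h1]
  clear h
  induction m with
  | zero => norm_num
  | succ m ih =>
    rw [Finset.prod_range_succ]
    refine (mul_le_mul ih (div_le_div_of_nonneg_left (c := (m : ℝ) + 3) (by positivity)
      (by positivity) (by linarith)) (by positivity) (by positivity)).trans_eq ?_
    push_cast
    field_simp
    ring

theorem ae_tendsto_prod_one_sub_limitFraction : ∀ᵐ ω ∂μ,
    Tendsto (fun m => ∏ i ∈ Finset.range m, (1 - limitFraction G i ω)) atTop (𝓝 0) := by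
  set Z : ℕ → Ω → ℝ := fun m ω => ∏ i ∈ Finset.range m, (1 - limitFraction G i ω) with hZ
  have h01 := ae_limitFraction_mem hk hG hind hunif
  have hZ0 : ∀ᵐ ω ∂μ, ∀ m, 0 ≤ Z m ω := by
    filter_upwards [h01] with ω h m
    exact Finset.prod_nonneg fun i _ => sub_nonneg.2 (h i).2
  have hlim : ∀ᵐ ω ∂μ, Tendsto (fun m => Z m ω) atTop (𝓝 (⨅ m, Z m ω)) := by
    filter_upwards [h01, hZ0] with ω h h0
    refine tendsto_atTop_ciInf (antitone_nat_of_succ_le fun m => ?_)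
      ⟨0, by rintro _ ⟨m, rfl⟩; exact h0 m⟩
    simp only [hZ, Finset.prod_range_succ]
    exact mul_le_of_le_one_right (h0 m) (by linarith [(h m).1])
  have hmeas : ∀ m, Measurable (Z m) := fun m => Finset.measurable_prod _ fun i _ =>
    (measurable_limitFraction hG i).const_sub 1
  have hbound : ∀ m, ∀ᵐ ω ∂μ, ‖Z m ω‖ ≤ 1 := by
    intro m
    filter_upwards [h01, hZ0] with ω h h0
    rw [Real.norm_of_nonneg (h0 m)]
    exact Finset.prod_le_one (fun i _ => sub_nonneg.2 (h i).2) fun i _ => by linarith [(h i).1]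
  have hint := tendsto_integral_of_dominated_convergence (fun _ => (1 : ℝ))
    (fun m => (hmeas m).aestronglyMeasurable) (integrable_const _) hbound hlim
  have hzero : Tendsto (fun m => ∫ ω, Z m ω ∂μ) atTop (𝓝 0) := by
    refine squeeze_zero (fun m => integral_nonneg_of_ae (hZ0.mono fun ω h => h m))
      (integral_prod_one_sub_limitFraction_le hk hG hind hunif) ?_
    exact (tendsto_atTop_add_const_right _ _ tendsto_natCast_atTop_atTop).const_div_atTop _
  have hI : ∫ ω, ⨅ m, Z m ω ∂μ = 0 := tendsto_nhds_unique hint hzero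
  have hI0 : 0 ≤ᵐ[μ] fun ω => ⨅ m, Z m ω := by
    filter_upwards [hZ0] with ω h using le_ciInf h
  have hInt : Integrable (fun ω => ⨅ m, Z m ω) μ := by
    refine Integrable.of_bound (C := 1) (Measurable.iInf hmeas).aestronglyMeasurable ?_
    filter_upwards [hlim, ae_all_iff.2 hbound] with ω h hb
    exact le_of_tendsto h.norm (Eventually.of_forall hb)
  have := (integral_eq_zero_iff_of_nonneg_ae hI0 hInt).1 hI
  filter_upwards [hlim, this] with ω h1 h2
  rw [h2] at h1
  exact h1

end Limit

/-! ### Stick breaking and the Poisson-Dirichlet distribution -/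

theorem sum_stickBreaking (b : ℕ → ℝ) (m : ℕ) :
    ∑ i ∈ Finset.range m, stickBreaking b i = 1 - ∏ j ∈ Finset.range m, (1 - b j) := by
  induction m with
  | zero => simp
  | succ m ih =>
    rw [Finset.sum_range_succ, ih, Finset.prod_range_succ, stickBreaking]
    ring

theorem stickBreaking_pos {b : ℕ → ℝ} (hb : ∀ i, b i ∈ Set.Ioo (0 : ℝ) 1) (i : ℕ) :
    0 < stickBreaking b i :=
  mul_pos (hb i).1 (Finset.prod_pos fun j _ => sub_pos.2 (hb j).2)

theorem hasSum_stickBreaking {b : ℕ → ℝ} (hb : ∀ i, b i ∈ Set.Ioo (0 : ℝ) 1)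
    (h : Tendsto (fun m => ∏ j ∈ Finset.range m, (1 - b j)) atTop (𝓝 0)) :
    HasSum (stickBreaking b) 1 := by
  rw [hasSum_iff_tendsto_nat_of_nonneg fun i => (stickBreaking_pos hb i).le]
  simp_rw [sum_stickBreaking]
  simpa using h.const_sub 1

theorem IsStirlingPerm.eq_nil {k : ℕ} {l : List ℕ} (h : IsStirlingPerm k 0 l) : l = [] := by
  rw [List.eq_nil_iff_forall_not_mem]
  intro a ha
  have := h.1 a
  rw [if_neg (by omega)] at this
  exact List.count_eq_zero.1 this ha

theorem hasLaw_decreasingRearrangement_stickBreaking {Ω : Type*} [MeasurableSpace Ω]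
    {μ : Measure Ω} [IsProbabilityMeasure μ] {α θ : ℝ} {β : ℕ → Ω → ℝ}
    (hm : ∀ i, Measurable (β i)) (hind : iIndepFun β μ)
    (hlaw : ∀ m : ℕ, HasLaw (β m) (betaMeasure (1 - α) (θ + ((m : ℝ) + 1) * α)) μ) :
    HasLaw (fun ω => decreasingRearrangement (stickBreaking fun m => β m ω))
      (poissonDirichlet α θ) μ := by
  have hmeas : Measurable fun ω m => β m ω := measurable_pi_lambda _ hm
  have h := hind.hasLaw_infinitePi hlaw hmeas.aemeasurable
  have hd : Measurable fun b => decreasingRearrangement (stickBreaking b) :=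
    measurable_decreasingRearrangement.comp measurable_stickBreaking
  refine ⟨(hd.comp hmeas).aemeasurable, ?_⟩
  unfold poissonDirichlet
  rw [← h.map_eq, Measure.map_map hd hmeas]
  rfl

theorem mainTheorem5 {Ω : Type*} [MeasurableSpace Ω] (μ : Measure Ω) [IsProbabilityMeasure μ]
    (k : ℕ) (hk : 2 ≤ k) (σ : (n : ℕ) → Ω → StirlingPerm k n) (hσ : IsRandomGrowth k μ σ) :
    ∃ β V' V : ℕ → Ω → ℝ,
      (∀ m, Measurable (β m)) ∧
      iIndepFun β μ ∧
      (∀ m : ℕ, HasLaw (β m) (betaMeasure (((k : ℝ) - 1) / k) (((m : ℝ) + 2) / k)) μ) ∧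
      (∀ ω i, V' i ω = stickBreaking (fun m => β m ω) i) ∧
      (∀ᵐ ω ∂μ, ∀ i, Tendsto (fun n : ℕ => (labelBlockSize (σ n ω).1 i : ℝ) / ((k : ℝ) * n))
        atTop (𝓝 (V' i ω))) ∧
      (∀ ω i, V i ω = decreasingRearrangement (fun j => V' j ω) i) ∧
      HasLaw (fun ω i => V i ω) (poissonDirichlet (1 / (k : ℝ)) (1 / (k : ℝ))) μ ∧
      (∀ᵐ ω ∂μ, (∀ i, 0 ≤ V i ω) ∧ Antitone (fun i => V i ω) ∧ HasSum (fun i => V i ω) 1) ∧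
      (∀ᵐ ω ∂μ, ∀ i, Tendsto (fun n : ℕ => (sortedBlockSize (σ n ω).1 i : ℝ) / ((k : ℝ) * n))
        atTop (𝓝 (V i ω))) ∧
      (∀ᵐ ω ∂μ, Tendsto
        (fun n : ℕ => ∑' i, |(sortedBlockSize (σ n ω).1 i : ℝ) / ((k : ℝ) * n) - V i ω|)
        atTop (𝓝 0)) ∧
      (∀ᵐ ω ∂μ, ∃ M : ℝ, IsGreatest (Set.range fun i => V' i ω) M ∧ V 0 ω = M ∧
        Tendsto (fun n : ℕ => (sortedBlockSize (σ n ω).1 0 : ℝ) / ((k : ℝ) * n))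
          atTop (𝓝 M)) := by
  obtain ⟨G, hG, hind, hunif, hgrow⟩ := hσ
  have hk0 : 0 < k := by omega
  have hkR : (0 : ℝ) < k := by exact_mod_cast hk0
  have hlaw : ∀ m, HasLaw (limitFraction G m)
      (betaMeasure (((k : ℝ) - 1) / k) (((m : ℝ) + 2) / k)) μ :=
    hasLaw_limitFraction hk hG hind hunif
  have hword : ∀ᵐ ω ∂μ, ∀ n, (σ n ω).1 = growWord k G n ω := by
    filter_upwards [hgrow] with ω h n
    induction n with
    | zero => exact (σ 0 ω).2.eq_nil
    | succ n ih =>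
      rw [h n, growWord, ← ih]
      rfl
  have hsum : ∀ᵐ ω ∂μ, HasSum (stickBreaking fun m => limitFraction G m ω) 1 := by
    filter_upwards [ae_limitFraction_mem_Ioo hk hG hind hunif,
      ae_tendsto_prod_one_sub_limitFraction hk hG hind hunif] with ω h1 h2
    exact hasSum_stickBreaking h1 h2
  have hconv : ∀ᵐ ω ∂μ, ∀ i, Tendsto (fun n : ℕ =>
      (labelBlockSize (σ n ω).1 i : ℝ) / ((k : ℝ) * n))
      atTop (𝓝 (stickBreaking (fun m => limitFraction G m ω) i)) := by
    filter_upwards [hword, ae_tendsto_labelBlockSize hk hG hind hunif] with ω h1 h2 i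
    simpa only [h1] using h2 i
  have hev : ∀ᶠ n : ℕ in atTop, (0 : ℝ) < (k : ℝ) * n :=
    (tendsto_mul_natCast_atTop hk0).eventually_gt_atTop 0
  have hone : ∀ᵐ ω ∂μ, ∀ᶠ n : ℕ in atTop,
      HasSum (fun j => (labelBlockSize (σ n ω).1 j : ℝ) / ((k : ℝ) * n)) 1 := by
    filter_upwards [hword] with ω h
    filter_upwards [hev] with n hn
    rw [h n]
    exact (isGrown_growWord hk0 G n ω).hasSum_labelBlockSize hn
  have hpos : ∀ᵐ ω ∂μ, ∀ i, 0 < stickBreaking (fun m => limitFraction G m ω) i := by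
    filter_upwards [ae_limitFraction_mem_Ioo hk hG hind hunif] with ω h using stickBreaking_pos h
  have hsorted : ∀ᵐ ω ∂μ, ∀ i, Tendsto (fun n : ℕ =>
      (sortedBlockSize (σ n ω).1 i : ℝ) / ((k : ℝ) * n)) atTop
      (𝓝 (decreasingRearrangement (stickBreaking fun m => limitFraction G m ω) i)) := by
    filter_upwards [hsum, hconv, hone, hpos] with ω h1 h2 h3 h4 i
    refine (tendsto_decreasingRearrangement (h3.mono fun n h => h.summable) h1.summable
      (tendsto_tsum_abs_sub h3 (fun n j => by positivity) h1 (fun j => (h4 j).le) h2) i).congr' ?_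
    filter_upwards [hev] with n hn
    rw [sortedBlockSize_div_eq _ hn]
  refine ⟨limitFraction G, fun i ω => stickBreaking (fun m => limitFraction G m ω) i,
    fun i ω => decreasingRearrangement (stickBreaking fun m => limitFraction G m ω) i,
    measurable_limitFraction hG, iIndepFun_limitFraction hk hG hind hunif, hlaw,
    fun _ _ => rfl, hconv, fun _ _ => rfl, ?_, ?_, hsorted, ?_, ?_⟩
  · refine hasLaw_decreasingRearrangement_stickBreaking (measurable_limitFraction hG)
      (iIndepFun_limitFraction hk hG hind hunif) fun m => ?_
    convert! hlaw m using 2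
    · field_simp
    · field_simp
      ring
  · filter_upwards [hsum, hpos] with ω h1 h2
    exact ⟨decreasingRearrangement_nonneg _,
      antitone_decreasingRearrangement h1.summable.bddAbove_range,
      h1.decreasingRearrangement fun j => (h2 j).le⟩
  · filter_upwards [hsum, hone, hpos, hsorted] with ω h1 h2 h3 h4
    refine tendsto_tsum_abs_sub (S := 1) ?_ (fun n j => by positivity)
      (h1.decreasingRearrangement fun j => (h3 j).le) (decreasingRearrangement_nonneg _) h4
    filter_upwards [h2, hev] with n hn hn0
    simp_rw [sortedBlockSize_div_eq _ hn0]
    exact hn.decreasingRearrangement fun j => by positivity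
  · filter_upwards [hsum, hpos, hsorted] with ω h1 h2 h3
    exact ⟨_, isGreatest_decreasingRearrangement_zero h1.summable ⟨0, h2 0⟩, rfl, h3 0⟩
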